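/- **Setting.** Let $M$ be a (Hausdorff, second countable) $C^1$ manifold of dimension $m$, $f:M\to M$ a $C^1$ map, $\mu$ an $f$-ergodic Borel probability measure with compact support $\Omega$, and $\varphi:M\to\mathbb R^d$ a $C^1$ measurement. Let $\Phi:\Omega\to\mathbb R^L$ be injective with $\Phi\circ f=g\circ(\varphi,\Phi)$ on $\Omega$ for some $g:\mathbb R^d\times\mathbb R^L\to\mathbb R^L$, and for $n\in\mathbb N=\{0,1,2,\dots\}$ let $w_n:\mathbb R^L\to\mathbb R^d$ satisfy $w_n\circ\Phi=\varphi\circ f^n$ on $\Omega$. Let $U\psi=\psi\circ f$ be the Koopman operator on $L^2(\mu)$, and let $\mathcal D$ be the closed linear span in complex $L^2(\mu)$ of the eigenfunctions of $U$ (for vector-valued functions: componentwise). The map $f$ is *weakly mixing* if $\mathcal D$ consists of the constants only, *strongly mixing* if $\mu(A\cap f^{-n}B)\to\mu(A)\mu(B)$ for all measurable $A,B$, and has *purely discrete spectrum* if $\mathcal D=L^2(\mu)$. Fix $\mathbb K\in\{\mathbb R,\mathbb C\}$. Let $\mathcal H$ be a linear space of functions $h:\mathbb R^L\to\mathbb K^d$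 with $h\circ\Phi\in L^2(\mu;\mathbb K^d)$, let $\mathcal W=\mathcal W(\mathcal H)=\{h\circ\Phi: h\in\mathcal H\}\subseteq L^2(\mu;\mathbb K^d)$, and let $\pi=\pi_{\mathcal W}$ be the orthogonal projection onto $\mathcal W$ (onto its closure, if $\mathcal W$ is not closed). Let $\hat w_n\in\mathcal H$ be a closest approximation of $w_n$, that is, $\hat w_n$ minimizes $\|w_n\circ\Phi-h\circ\Phi\|_{L^2(\mu)}$ over $h\in\mathcal H$, and put $\mathrm{error}_{\mathrm{direct}}(n)=\|U^n\varphi-\hat w_n\circ\Phi\|_{L^2(\mu)}$. **Theorem 5.1 (error from direct forecast).** Whenever a closest approximation $\hat w_n$ exists, $$\mathrm{error}_{\mathrm{direct}}(n)=\|(\mathrm{Id}-\pi)U^n\varphi\|_{L^2(\mu)} .$$ Call $\mathcal H$ (or $\mathcal W$) a *hypothesis space* if $\mathcal W$ is finite-dimensional and contains the constant functions; then closest approximations exist for all $n$. There is a set $\mathbb N'\subseteq\mathbb N$ of natural density $1$, not depending on the hypothesis space, such that the following holds. Put $c=\|\varphi-\mathrm{proj}_{\mathcal D}\varphi\|_{L^2(\mu)}$.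 1. For every hypothesis space $\mathcal W$, $\liminf_{n\in\mathbb N',\,n\to\infty}\mathrm{error}_{\mathrm{direct}}(n)\ge c$. For every $\epsilon>0$ there is a hypothesis space $\mathcal W_0$ for which $\lim_{n\in\mathbb N',\,n\to\infty}\mathrm{error}_{\mathrm{direct}}(n)$ exists and lies in $[c,c+\epsilon)$, and such that for every hypothesis space $\mathcal W\supseteq\mathcal W_0$ one has $\mathrm{error}_{\mathrm{direct}}(n)<c+\epsilon$ for all sufficiently large $n\in\mathbb N'$. 2. If $f$ is weakly mixing, then for every hypothesis space $\lim_{n\in\mathbb N',\,n\to\infty}\mathrm{error}_{\mathrm{direct}}(n)=\|\varphi-\mu(\varphi)\|_{L^2(\mu)}$, where $\mu(\varphi)=\int\varphi\,d\mu$. 3. If $f$ is strongly mixing, then $\mathbb N'$ can be taken to be $\mathbb N$; in particular, for every hypothesis space $\lim_{n\to\infty}\mathrm{error}_{\mathrm{direct}}(n)=\|\varphi-\mu(\varphi)\|_{L^2(\mu)}$. 4. If $f$ has purely discrete spectrum, then for every $\epsilon>0$ there is a hypothesis space $\mathcal W_0$ such that for every hypothesis space $\mathcal W\supseteq\mathcal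 W_0$ one has $\mathrm{error}_{\mathrm{direct}}(n)<\epsilon$ for all $n\in\mathbb N$. -/

import Mathlib

open MeasureTheory Filter Topology
open scoped ENNReal Manifold

namespace DirectForecast

/-- A set of natural numbers has (natural) density one: `|A ∩ {0, …, N-1}| / N → 1`. -/
def HasDensityOne (A : Set ℕ) : Prop :=
  Tendsto (fun N : ℕ => ((A ∩ Set.Iio N).ncard : ℝ) / (N : ℝ)) atTop (𝓝 1)

/-- A measure on a second countable space with compact support makes every continuous function
square integrable. -/
theorem memLp_of_isCompact_support {M E : Type*} [TopologicalSpace M] [SecondCountableTopology M]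
    [MeasurableSpace M] [BorelSpace M] [NormedAddCommGroup E] [SecondCountableTopology E]
    {μ : Measure M} [IsProbabilityMeasure μ]
    (hμ : IsCompact μ.support) {ψ : M → E} (hψ : Continuous ψ) : MemLp ψ 2 μ := by
  borelize E
  obtain ⟨C, hC⟩ := hμ.exists_bound_of_continuousOn hψ.continuousOn
  refine MemLp.of_bound hψ.stronglyMeasurable.aestronglyMeasurable C ?_
  filter_upwards [Measure.support_mem_ae (μ := μ)] with x hx using hC x hx

/-- The coordinatewise inclusion `ℝ^d → 𝕜^d`, for `𝕜 = ℝ` (the identity) or `𝕜 = ℂ`. -/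
def ofRealVec (𝕜 : Type*) [RCLike 𝕜] {d : ℕ} (v : EuclideanSpace ℝ (Fin d)) :
    EuclideanSpace 𝕜 (Fin d) :=
  WithLp.toLp 2 fun i => ((v i : ℝ) : 𝕜)

theorem continuous_ofRealVec (𝕜 : Type*) [RCLike 𝕜] {d : ℕ} :
    Continuous (ofRealVec 𝕜 (d := d)) := by
  unfold ofRealVec
  refine (PiLp.continuous_toLp 2 _).comp (continuous_pi fun i => ?_)
  exact RCLike.continuous_ofReal.comp (PiLp.continuous_apply 2 _ i)

section Koopman

variable {M : Type*} [MeasurableSpace M] {μ : Measure M} {f : M → M}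

/-- The Koopman operator `U ψ = ψ ∘ f` on the space of square integrable `E`-valued functions,
for a measure preserving map `f`. -/
noncomputable def koopman (𝕜 E : Type*) [RCLike 𝕜] [NormedAddCommGroup E] [NormedSpace 𝕜 E]
    (hf : MeasurePreserving f μ μ) : Lp E 2 μ →ₗ[𝕜] Lp E 2 μ :=
  (Lp.compMeasurePreservingₗᵢ 𝕜 f hf).toLinearMap

/-- The space `𝒟`: the closed linear span of the eigenfunctions of the Koopman operator on the
complex Hilbert space `L²(μ; E)`. For `E = ℂ^d` it consists of the functions all of whose
components lie in the space `𝒟` of scalar functions. -/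
noncomputable abbrev discreteSubspace (E : Type*) [NormedAddCommGroup E] [NormedSpace ℂ E]
    (hf : MeasurePreserving f μ μ) : Submodule ℂ (Lp E 2 μ) :=
  (Submodule.span ℂ {ψ : Lp E 2 μ |
    ∃ c : ℂ, Module.End.HasEigenvector (koopman ℂ E hf) c ψ}).topologicalClosure

/-- Weak mixing: the only eigenfunctions are the constants, `𝒟 = ℂ · 1`. -/
def IsWeaklyMixing [IsFiniteMeasure μ] (hf : MeasurePreserving f μ μ) : Prop :=
  discreteSubspace ℂ hf = Submodule.span ℂ {Lp.const 2 μ (1 : ℂ)}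

/-- Strong mixing: `μ(A ∩ f⁻ⁿ B) → μ(A) μ(B)` for all measurable `A`, `B`. -/
def IsStronglyMixing (μ : Measure M) (f : M → M) : Prop :=
  ∀ A B : Set M, MeasurableSet A → MeasurableSet B →
    Tendsto (fun n : ℕ => μ (A ∩ f^[n] ⁻¹' B)) atTop (𝓝 (μ A * μ B))

/-- Purely discrete spectrum: the eigenfunctions span a dense subspace, `𝒟 = L²(μ)`. -/
def HasPurelyDiscreteSpectrum (hf : MeasurePreserving f μ μ) : Prop :=
  discreteSubspace ℂ hf = ⊤

end Koopman

section Hypothesis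

variable {M : Type*} [MeasurableSpace M] {𝕜 : Type*} [RCLike 𝕜] {d L : ℕ}

/-- The subspace `𝒲 = {h ∘ Φ : h ∈ H}` of `L²(μ; 𝕜^d)` associated with a linear space `H` of
functions `ℝ^L → 𝕜^d` and the map `Φ` (elements of `L²` are classes modulo null sets). -/
def hypSubspace (μ : Measure M) (Φ : M → EuclideanSpace ℝ (Fin L))
    (H : Submodule 𝕜 (EuclideanSpace ℝ (Fin L) → EuclideanSpace 𝕜 (Fin d))) :
    Submodule 𝕜 (Lp (EuclideanSpace 𝕜 (Fin d)) 2 μ) where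
  carrier := {ψ | ∃ h ∈ H, ψ =ᵐ[μ] fun ω => h (Φ ω)}
  zero_mem' := ⟨0, H.zero_mem, Lp.coeFn_zero _ _ _⟩
  add_mem' := by
    rintro a b ⟨h, hh, ha⟩ ⟨k, hk, hb⟩
    refine ⟨h + k, H.add_mem hh hk, (Lp.coeFn_add a b).trans ?_⟩
    filter_upwards [ha, hb] with ω h1 h2
    simp [h1, h2]
  smul_mem' := by
    rintro c a ⟨h, hh, ha⟩
    refine ⟨c • h, H.smul_mem c hh, (Lp.coeFn_smul c a).trans ?_⟩
    filter_upwards [ha] with ω h1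
    simp [h1]

/-- Every `h ∘ Φ`, `h ∈ H`, is square integrable. -/
def IsSquareIntegrableClass (μ : Measure M) (Φ : M → EuclideanSpace ℝ (Fin L))
    (H : Submodule 𝕜 (EuclideanSpace ℝ (Fin L) → EuclideanSpace 𝕜 (Fin d))) : Prop :=
  ∀ h ∈ H, MemLp (fun ω => h (Φ ω)) 2 μ

/-- A hypothesis space: `𝒲` is a finite-dimensional subspace of `L²(μ)` that contains the
constants. -/
structure IsHypothesisSpace (μ : Measure M) [IsFiniteMeasure μ]
    (Φ : M → EuclideanSpace ℝ (Fin L))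
    (H : Submodule 𝕜 (EuclideanSpace ℝ (Fin L) → EuclideanSpace 𝕜 (Fin d))) : Prop where
  memLp : IsSquareIntegrableClass μ Φ H
  finiteDimensional : FiniteDimensional 𝕜 (hypSubspace μ Φ H)
  const_mem : ∀ c : EuclideanSpace 𝕜 (Fin d), Lp.const 2 μ c ∈ hypSubspace μ Φ H

/-- `wHat` is a closest approximation, in the `L²(μ)` distance after composition with `Φ`, of
`w : ℝ^L → ℝ^d` among the members of `H`. -/
def IsClosestApprox (μ : Measure M) (Φ : M → EuclideanSpace ℝ (Fin L))
    (H : Submodule 𝕜 (EuclideanSpace ℝ (Fin L) → EuclideanSpace 𝕜 (Fin d)))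
    (w : EuclideanSpace ℝ (Fin L) → EuclideanSpace ℝ (Fin d))
    (wHat : EuclideanSpace ℝ (Fin L) → EuclideanSpace 𝕜 (Fin d)) : Prop :=
  wHat ∈ H ∧ ∀ h ∈ H,
    eLpNorm (fun ω => ofRealVec 𝕜 (w (Φ ω)) - wHat (Φ ω)) 2 μ ≤
      eLpNorm (fun ω => ofRealVec 𝕜 (w (Φ ω)) - h (Φ ω)) 2 μ

/-- The direct forecast error `‖φ ∘ fⁿ - ŵ ∘ Φ‖_{L²(μ)}` at time `n` of an estimate `ŵ`. -/
noncomputable def directError (μ : Measure M) (f : M → M)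
    (φ : M → EuclideanSpace ℝ (Fin d)) (Φ : M → EuclideanSpace ℝ (Fin L))
    (wHat : EuclideanSpace ℝ (Fin L) → EuclideanSpace 𝕜 (Fin d)) (n : ℕ) : ℝ :=
  (eLpNorm (fun ω => ofRealVec 𝕜 (φ (f^[n] ω)) - wHat (Φ ω)) 2 μ).toReal

/-- The orthogonal projection `π` of `L²(μ; 𝕜^d)` onto `𝒲`. (An infinite-dimensional `𝒲` need
not be closed, and is replaced by its closure; a finite-dimensional one is closed.) -/
noncomputable def hypProj (μ : Measure M) (Φ : M → EuclideanSpace ℝ (Fin L))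
    (H : Submodule 𝕜 (EuclideanSpace ℝ (Fin L) → EuclideanSpace 𝕜 (Fin d))) :
    Lp (EuclideanSpace 𝕜 (Fin d)) 2 μ →L[𝕜] Lp (EuclideanSpace 𝕜 (Fin d)) 2 μ :=
  (hypSubspace μ Φ H).topologicalClosure.starProjection

end Hypothesis

section Observable

variable {M : Type*} [TopologicalSpace M] [SecondCountableTopology M] [MeasurableSpace M]
  [BorelSpace M] {μ : Measure M} [IsProbabilityMeasure μ] {d : ℕ}

/-- The measurement `φ` as an element of `L²(μ; 𝕜^d)`. -/
noncomputable def obsL2 (𝕜 : Type*) [RCLike 𝕜] (hμ : IsCompact μ.support)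
    {φ : M → EuclideanSpace ℝ (Fin d)} (hφ : Continuous φ) :
    Lp (EuclideanSpace 𝕜 (Fin d)) 2 μ :=
  (memLp_of_isCompact_support hμ ((continuous_ofRealVec 𝕜).comp hφ)).toLp

/-- The distance `‖φ - proj_𝒟 φ‖_{L²(μ)}` of the measurement to the space `𝒟`. -/
noncomputable def mixingResidual (hμ : IsCompact μ.support)
    {φ : M → EuclideanSpace ℝ (Fin d)} (hφ : Continuous φ) {f : M → M}
    (hf : MeasurePreserving f μ μ) : ℝ :=
  ‖obsL2 ℂ hμ hφ -
    (discreteSubspace (EuclideanSpace ℂ (Fin d)) hf).starProjection (obsL2 ℂ hμ hφ)‖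

end Observable

/-- The standard deviation `‖φ - μ(φ)‖_{L²(μ)}`. -/
noncomputable def stdDev {M : Type*} [MeasurableSpace M] {d : ℕ} (μ : Measure M)
    (φ : M → EuclideanSpace ℝ (Fin d)) : ℝ :=
  (eLpNorm (fun ω => φ ω - ∫ x, φ x ∂μ) 2 μ).toReal

end DirectForecast

open DirectForecast

/-!
The direct error at time `n` is the distance from `Uⁿ φ` to the hypothesis space `𝒲`. Split
`φ = a + b` with `a` in the closure `K` of the union of the finite-dimensional `U`-invariant
subspaces and `b ⟂ K`.

* The orbit of `b` is weakly null along a set of density one. Indeed, the averages of the rank-one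
  operators `⟪Uⁿ b, ·⟫ Uⁿ b` have as weak limits along ultrafilters positive operators of finite
  trace with `U`-invariant quadratic form. If such a limit is nonzero, its eigenspace at the norm
  is a finite-dimensional invariant subspace not orthogonal to `b`, which is impossible. So the
  quadratic correlations of `b` vanish on average, and a nonnegative sequence that vanishes on
  average tends to zero along a set of density one. Under strong mixing the whole sequence is
  weakly null.
* The projections of a weakly null sequence to the finite-dimensional `𝒲` tend to zero in norm,
  and `⟪Uⁿ a, Uⁿ b⟫ = 0`, so the distance from `Uⁿ φ` to `𝒲` is eventually at least `‖b‖ - η`.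
* The distance to a finite-dimensional invariant subspace is constant along orbits. Since `Φ` is
  injective on the support of `μ`, each such subspace comes from a hypothesis space, which gives
  the upper bounds.

Over `ℂ` the space `K` is the closed span `𝒟` of the eigenvectors. The real case is compared with
the complex one through real parts, which map invariant subspaces to invariant subspaces.
-/

namespace DirectForecast

section PositiveOperator

variable {𝕜 E : Type*} [RCLike 𝕜] [NormedAddCommGroup E] [InnerProductSpace 𝕜 E]

theorem norm_apply_sq_le_of_isPositive {K : E →L[𝕜] E} (hK : K.IsPositive) (y : E) :
    ‖K y‖ ^ 2 ≤ ‖K‖ * RCLike.re (inner 𝕜 (K y) y) := by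
  rcases eq_or_ne K 0 with rfl | hK₀
  · simp
  have hpos : 0 < ‖K‖ := norm_pos_iff.2 hK₀
  -- Positivity of the quadratic form at `y - ‖K‖⁻¹ • K y`.
  have hform := hK.re_inner_nonneg_left (y - ((‖K‖⁻¹ : ℝ) : 𝕜) • K y)
  have hcross : inner 𝕜 (K (K y)) y = inner 𝕜 (K y) (K y) := hK.inner_left_eq_inner_right _ _
  simp only [map_sub, map_smul, inner_sub_left, inner_sub_right, inner_smul_left,
    inner_smul_right, hcross, RCLike.conj_ofReal, RCLike.re_ofReal_mul,
    inner_self_eq_norm_sq] at hform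
  have hquad : ‖K‖⁻¹ * RCLike.re (inner 𝕜 (K (K y)) (K y)) ≤ ‖K y‖ ^ 2 := by
    rw [inv_mul_le_iff₀ hpos]
    grw [RCLike.re_le_norm, norm_inner_le_norm, K.le_opNorm]
    exact le_of_eq (by ring)
  have hscaled := mul_le_mul_of_nonneg_left hquad (inv_nonneg.2 hpos.le)
  rw [← inv_mul_le_iff₀ hpos]
  linarith

theorem norm_comp_sub_starProjection_le {K : E →L[𝕜] E} (hK : K.IsPositive)
    {F : Submodule 𝕜 E} [F.HasOrthogonalProjection] {δ : ℝ} (hδ : 0 ≤ δ)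
    (hF : ∀ x ∈ Fᗮ, RCLike.re (inner 𝕜 (K x) x) ≤ δ * ‖x‖ ^ 2) :
    ‖K - K.comp F.starProjection‖ ≤ √(‖K‖ * δ) := by
  refine ContinuousLinearMap.opNorm_le_bound _ (Real.sqrt_nonneg _) fun x => ?_
  have hmem : x - F.starProjection x ∈ Fᗮ := F.sub_starProjection_mem_orthogonal x
  have hle : ‖x - F.starProjection x‖ ≤ ‖x‖ := by
    simpa only [Submodule.starProjection_orthogonal_val] using Fᗮ.norm_starProjection_apply_le x
  have happly : (K - K.comp F.starProjection) x = K (x - F.starProjection x) := by simp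
  rw [happly, ← abs_of_nonneg (norm_nonneg x), ← Real.sqrt_sq_eq_abs,
    ← Real.sqrt_mul (by positivity)]
  refine Real.le_sqrt_of_sq_le ?_
  grw [norm_apply_sq_le_of_isPositive hK, hF _ hmem, hle, mul_assoc]

theorem isCompactOperator_of_forall_exists_finiteDimensional [CompleteSpace E] {K : E →L[𝕜] E}
    (hK : K.IsPositive)
    (hF : ∀ δ : ℝ, 0 < δ → ∃ F : Submodule 𝕜 E, FiniteDimensional 𝕜 F ∧
      ∀ x ∈ Fᗮ, RCLike.re (inner 𝕜 (K x) x) ≤ δ * ‖x‖ ^ 2) : IsCompactOperator K := by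
  refine isClosed_setOfPred_isCompactOperator.closure_subset (Metric.mem_closure_iff.2 ?_)
  intro ε hε
  obtain ⟨F, _, hFK⟩ := hF (ε ^ 2 / (‖K‖ + 1)) (by positivity)
  have hproj : IsCompactOperator F.starProjection := by
    have : ProperSpace F := FiniteDimensional.proper_rclike 𝕜 F
    exact (isCompactOperator_of_locallyCompactSpace_dom F.orthogonalProjectionOnto).clm_comp
      F.subtypeL
  refine ⟨K.comp F.starProjection, hproj.clm_comp K, ?_⟩
  rw [dist_eq_norm]
  refine (norm_comp_sub_starProjection_le hK (by positivity) hFK).trans_lt ?_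
  rw [Real.sqrt_lt' hε, mul_div_left_comm]
  exact mul_lt_of_lt_one_right (by positivity) ((div_lt_one (by positivity)).2 (lt_add_one _))

theorem orthonormal_finCons {n : ℕ} {e : Fin n → E} (he : Orthonormal 𝕜 e) {z : E}
    (hz : ‖z‖ = 1) (hze : ∀ i, inner 𝕜 (e i) z = 0) :
    Orthonormal 𝕜 (Fin.cons z e : Fin (n + 1) → E) := by
  refine ⟨Fin.cases (by simpa using hz) (by simpa using he.1), ?_⟩
  refine Fin.cases (Fin.cases (by simp) fun j _ => ?_)
    fun i => Fin.cases (fun _ => by simpa using hze i) fun j hij => ?_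
  · simpa using inner_eq_zero_symm.1 (hze j)
  · simpa using he.2 fun h => hij (by rw [h])

theorem exists_finiteDimensional_re_inner_le {K : E →L[𝕜] E} {C : ℝ}
    (hC : ∀ (n : ℕ) (e : Fin n → E), Orthonormal 𝕜 e →
      ∑ i, RCLike.re (inner 𝕜 (K (e i)) (e i)) ≤ C) {δ : ℝ} (hδ : 0 < δ) :
    ∃ F : Submodule 𝕜 E, FiniteDimensional 𝕜 F ∧
      ∀ x ∈ Fᗮ, RCLike.re (inner 𝕜 (K x) x) ≤ δ * ‖x‖ ^ 2 := by
  by_contra! hlarge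
  have hfamily : ∀ n : ℕ, ∃ e : Fin n → E, Orthonormal 𝕜 e ∧
      ∀ i, δ ≤ RCLike.re (inner 𝕜 (K (e i)) (e i)) := by
    intro n
    induction n with
    | zero => exact ⟨Fin.elim0, ⟨fun i => i.elim0, fun i => i.elim0⟩, fun i => i.elim0⟩
    | succ n ih =>
      obtain ⟨e, he, hδe⟩ := ih
      obtain ⟨x, hx, hδx⟩ := hlarge (Submodule.span 𝕜 (Set.range e))
        (FiniteDimensional.span_of_finite 𝕜 (Set.finite_range e))
      have hx₀ : x ≠ 0 := by rintro rfl; simp at hδx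
      have horth : ∀ i, inner 𝕜 (e i) (((‖x‖⁻¹ : ℝ) : 𝕜) • x) = 0 := fun i => by
        rw [inner_smul_right, hx _ (Submodule.subset_span ⟨i, rfl⟩), mul_zero]
      have hnorm : ‖((‖x‖⁻¹ : ℝ) : 𝕜) • x‖ = 1 := by
        simpa using norm_smul_inv_norm (𝕜 := 𝕜) hx₀
      refine ⟨_, orthonormal_finCons he hnorm horth, Fin.cases ?_ hδe⟩
      calc δ = ‖x‖⁻¹ * (‖x‖⁻¹ * (δ * ‖x‖ ^ 2)) := by field_simp
        _ ≤ ‖x‖⁻¹ * (‖x‖⁻¹ * RCLike.re (inner 𝕜 (K x) x)) := by gcongr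
        _ = _ := by
          simp only [Fin.cons_zero, map_smul, inner_smul_left, inner_smul_right,
            RCLike.conj_ofReal, RCLike.re_ofReal_mul]
  obtain ⟨n, hn⟩ := exists_nat_gt (C / δ)
  obtain ⟨e, he, hδe⟩ := hfamily n
  refine (div_lt_iff₀ hδ).1 hn |>.not_ge ?_
  calc (n : ℝ) * δ = ∑ _i : Fin n, δ := by simp
    _ ≤ ∑ i, RCLike.re (inner 𝕜 (K (e i)) (e i)) := Finset.sum_le_sum fun i _ => hδe i
    _ ≤ C := hC n e he

theorem isCompactOperator_of_trace_le [CompleteSpace E] {K : E →L[𝕜] E} (hK : K.IsPositive)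
    {C : ℝ} (hC : ∀ (n : ℕ) (e : Fin n → E), Orthonormal 𝕜 e →
      ∑ i, RCLike.re (inner 𝕜 (K (e i)) (e i)) ≤ C) : IsCompactOperator K :=
  isCompactOperator_of_forall_exists_finiteDimensional hK
    fun _ => exists_finiteDimensional_re_inner_le hC

theorem hasEigenvalue_norm_of_isPositive [CompleteSpace E] {K : E →L[𝕜] E}
    (hK : K.IsPositive) (hc : IsCompactOperator K) (hK₀ : K ≠ 0) :
    Module.End.HasEigenvalue (K : Module.End 𝕜 E) (‖K‖ : 𝕜) := by
  rw [hc.hasEigenvalue_iff_mem_spectrum (by simpa using hK₀)]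
  by_contra hmem
  have : Nontrivial E := not_subsingleton_iff_nontrivial.1 fun _ => hK₀ (Subsingleton.elim _ _)
  obtain ⟨ε, hε, hrayleigh⟩ := K.rayleighQuotient_le_of_norm_mem_resolventSet (not_not.1 hmem)
  have hgap : ‖K‖ ≤ ‖K‖ - ε := by
    conv_lhs => rw [K.norm_eq_iSup_rayleighQuotient hK.isSymmetric]
    refine ciSup_le fun x => ?_
    have hnonneg : 0 ≤ K.rayleighQuotient x :=
      div_nonneg (hK.re_inner_nonneg_left x) (by positivity)
    exact (abs_of_nonneg hnonneg).trans_le (hrayleigh x)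
  linarith

theorem mem_eigenspace_norm_iff {K : E →L[𝕜] E} {x : E} :
    x ∈ Module.End.eigenspace (K : Module.End 𝕜 E) (‖K‖ : 𝕜) ↔
      RCLike.re (inner 𝕜 (K x) x) = ‖K‖ * ‖x‖ ^ 2 := by
  rw [Module.End.mem_eigenspace_iff, ContinuousLinearMap.coe_coe]
  refine ⟨fun hx => ?_, fun hx => ?_⟩
  · rw [hx, inner_smul_left, RCLike.conj_ofReal, RCLike.re_ofReal_mul, inner_self_eq_norm_sq]
  · rw [← sub_eq_zero, ← norm_eq_zero, ← sq_eq_zero_iff]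
    refine le_antisymm ?_ (sq_nonneg _)
    rw [norm_sub_sq (𝕜 := 𝕜), inner_smul_right, RCLike.re_ofReal_mul, hx, norm_smul,
      RCLike.norm_ofReal, abs_norm]
    have := pow_le_pow_left₀ (norm_nonneg _) (K.le_opNorm x) 2
    linarith [mul_pow ‖K‖ ‖x‖ 2]

end PositiveOperator

section FinInvariant

variable {𝕜 E : Type*} [RCLike 𝕜] [NormedAddCommGroup E] [InnerProductSpace 𝕜 E]

/-- A finite-dimensional subspace mapped into itself by the isometry `U`. -/
structure IsFinInvariant (U : E →ₗᵢ[𝕜] E) (F : Submodule 𝕜 E) : Prop where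
  finiteDimensional : FiniteDimensional 𝕜 F
  mapsTo : Set.MapsTo U F F

theorem IsFinInvariant.sup {U : E →ₗᵢ[𝕜] E} {F G : Submodule 𝕜 E} (hF : IsFinInvariant U F)
    (hG : IsFinInvariant U G) : IsFinInvariant U (F ⊔ G) where
  finiteDimensional :=
    have := hF.finiteDimensional
    have := hG.finiteDimensional
    inferInstance
  mapsTo x hx := by
    obtain ⟨a, ha, b, hb, rfl⟩ := Submodule.mem_sup.1 hx
    rw [map_add]
    exact Submodule.add_mem_sup (hF.mapsTo ha) (hG.mapsTo hb)

theorem IsFinInvariant.surjOn {U : E →ₗᵢ[𝕜] E} {F : Submodule 𝕜 E} (hF : IsFinInvariant U F) :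
    Set.SurjOn U F F := by
  have := hF.finiteDimensional
  have hinj : Function.Injective (U.toLinearMap.restrict hF.mapsTo) := fun a b hab =>
    Subtype.ext (U.injective (congrArg Subtype.val hab))
  intro y hy
  obtain ⟨z, hz⟩ := LinearMap.injective_iff_surjective.1 hinj ⟨y, hy⟩
  exact ⟨z, z.2, congrArg Subtype.val hz⟩

theorem IsFinInvariant.mapsTo_orthogonal {U : E →ₗᵢ[𝕜] E} {F : Submodule 𝕜 E}
    (hF : IsFinInvariant U F) : Set.MapsTo U Fᗮ Fᗮ := by
  intro x hx y hy
  obtain ⟨z, hz, rfl⟩ := hF.surjOn hy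
  rw [U.inner_map_map]
  exact hx z hz

theorem IsFinInvariant.inf_orthogonal {U : E →ₗᵢ[𝕜] E} {F G : Submodule 𝕜 E}
    (hF : IsFinInvariant U F) (hG : IsFinInvariant U G) : IsFinInvariant U (F ⊓ Gᗮ) where
  finiteDimensional :=
    have := hF.finiteDimensional
    Submodule.finiteDimensional_inf_left F Gᗮ
  mapsTo _ hx := ⟨hF.mapsTo hx.1, hG.mapsTo_orthogonal hx.2⟩

theorem IsFinInvariant.infDist_iterate {U : E →ₗᵢ[𝕜] E} {F : Submodule 𝕜 E}
    (hF : IsFinInvariant U F) (n : ℕ) (x : E) :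
    Metric.infDist (U^[n] x) F = Metric.infDist x F := by
  have himage : U '' F = F := hF.mapsTo.image_subset.antisymm hF.surjOn
  induction n with
  | zero => rfl
  | succ n ih =>
    rw [Function.iterate_succ_apply', ← ih]
    nth_rw 1 [← himage]
    exact Metric.infDist_image U.isometry

/-- The union of the finite-dimensional subspaces invariant under `U`. -/
def finInvariantSpan (U : E →ₗᵢ[𝕜] E) : Submodule 𝕜 E where
  carrier := {x | ∃ F, IsFinInvariant U F ∧ x ∈ F}
  zero_mem' := ⟨⊥, ⟨inferInstance, by simp [Set.mapsTo_singleton]⟩, Submodule.zero_mem _⟩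
  add_mem' := by
    rintro a b ⟨F, hF, ha⟩ ⟨G, hG, hb⟩
    exact ⟨F ⊔ G, hF.sup hG, Submodule.add_mem_sup ha hb⟩
  smul_mem' := by
    rintro c a ⟨F, hF, ha⟩
    exact ⟨F, hF, F.smul_mem c ha⟩

theorem IsFinInvariant.le_finInvariantSpan {U : E →ₗᵢ[𝕜] E} {F : Submodule 𝕜 E}
    (hF : IsFinInvariant U F) : F ≤ finInvariantSpan U :=
  fun _ hx => ⟨F, hF, hx⟩

/-- The closure of the union of the finite-dimensional invariant subspaces: the space of vectors
with relatively compact orbit. Unlike the closed span of the eigenvectors, to which it is equal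
over `ℂ`, it is also the right space over `ℝ`. -/
abbrev compactSubspace (U : E →ₗᵢ[𝕜] E) : Submodule 𝕜 E :=
  (finInvariantSpan U).topologicalClosure

end FinInvariant

section KoopmanVonNeumann

variable {𝕜 E : Type*} [RCLike 𝕜] [NormedAddCommGroup E] [InnerProductSpace 𝕜 E]

theorem norm_birkhoffAverage_le (𝕜 : Type*) {α G : Type*} [RCLike 𝕜] [NormedAddCommGroup G]
    [NormedSpace 𝕜 G] {f : α → α} {g : α → G} {x : α} {C : ℝ}
    (hg : ∀ k, ‖g (f^[k] x)‖ ≤ C) (n : ℕ) : ‖birkhoffAverage 𝕜 f g n x‖ ≤ C := by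
  have hsum : ‖birkhoffSum f g n x‖ ≤ n * C := by
    simpa [birkhoffSum] using norm_sum_le_of_le (Finset.range n) fun k _ => hg k
  rw [birkhoffAverage, norm_smul, norm_inv, RCLike.norm_natCast]
  grw [hsum]
  rcases eq_or_ne (n : ℝ) 0 with hn | hn
  · simpa [hn] using (norm_nonneg _).trans (hg 0)
  · rw [inv_mul_cancel_left₀ hn]

theorem norm_iterate (U : E →ₗᵢ[𝕜] E) (n : ℕ) (x : E) : ‖U^[n] x‖ = ‖x‖ := by
  induction n with
  | zero => rfl
  | succ n ih => rw [Function.iterate_succ_apply', U.norm_map, ih]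

theorem exists_weak_limit [CompleteSpace E] (u : Ultrafilter ℕ) (T : ℕ → E →L[𝕜] E) {C : ℝ}
    (hT : ∀ n, ‖T n‖ ≤ C) :
    ∃ K : E →L[𝕜] E, ∀ x y, Tendsto (fun n => inner 𝕜 (T n x) y) u (𝓝 (inner 𝕜 (K x) y)) := by
  have hbound : ∀ x y n, ‖inner 𝕜 (T n x) y‖ ≤ C * ‖x‖ * ‖y‖ := fun x y n => by
    grw [norm_inner_le_norm, (T n).le_opNorm, hT n]
  have hlimit : ∀ x y, ∃ l : 𝕜, ‖l‖ ≤ C * ‖x‖ * ‖y‖ ∧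
      Tendsto (fun n => inner 𝕜 (T n x) y) u (𝓝 l) := fun x y => by
    obtain ⟨l, hl, h⟩ := (isCompact_closedBall (0 : 𝕜) (C * ‖x‖ * ‖y‖)).ultrafilter_le_nhds
      (u.map fun n => inner 𝕜 (T n x) y) (by
        rw [Ultrafilter.coe_map, le_principal_iff, mem_map]
        exact Filter.univ_mem' fun n => by simpa using hbound x y n)
    exact ⟨l, by simpa using hl, h⟩
  choose l hl_norm hl using hlimit
  let B : E →ₗ⋆[𝕜] E →ₗ[𝕜] 𝕜 := LinearMap.mk₂'ₛₗ (starRingEnd 𝕜) (RingHom.id 𝕜) l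
    (fun a b y => tendsto_nhds_unique (hl _ _)
      (((hl a y).add (hl b y)).congr fun n => by rw [map_add, inner_add_left]))
    (fun c a y => tendsto_nhds_unique (hl _ _)
      (((hl a y).const_smul ((starRingEnd 𝕜) c)).congr fun n => by
        rw [map_smul, inner_smul_left, smul_eq_mul]))
    (fun a x y => tendsto_nhds_unique (hl _ _)
      (((hl a x).add (hl a y)).congr fun n => by rw [inner_add_right]))
    (fun c a y => tendsto_nhds_unique (hl _ _)
      (((hl a y).const_smul c).congr fun n => by rw [inner_smul_right, smul_eq_mul]))
  refine ⟨InnerProductSpace.continuousLinearMapOfBilin (B.mkContinuous₂ C hl_norm), fun x y => ?_⟩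
  rw [InnerProductSpace.continuousLinearMapOfBilin_apply]
  exact hl x y

theorem isPositive_of_tendsto_inner {ι : Type*} {l : Filter ι} [l.NeBot] {T : ι → E →L[𝕜] E}
    (hT : ∀ i, (T i).IsPositive) {K : E →L[𝕜] E}
    (hK : ∀ x y, Tendsto (fun i => inner 𝕜 (T i x) y) l (𝓝 (inner 𝕜 (K x) y))) :
    K.IsPositive := by
  refine ⟨fun x y => ?_, fun x => ?_⟩
  · refine tendsto_nhds_unique (hK x y) ?_
    have hconj := (RCLike.continuous_conj.tendsto _).comp (hK y x)
    rw [inner_conj_symm] at hconj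
    refine hconj.congr fun i => ?_
    rw [Function.comp_apply, inner_conj_symm, (hT i).inner_left_eq_inner_right]
  · exact ge_of_tendsto ((RCLike.continuous_re.tendsto _).comp (hK x x))
      (Eventually.of_forall fun i => (hT i).re_inner_nonneg_left x)

theorem re_inner_rankOne_self (x y : E) :
    RCLike.re (inner 𝕜 (InnerProductSpace.rankOne 𝕜 y y x) x) = ‖inner 𝕜 y x‖ ^ 2 := by
  rw [InnerProductSpace.rankOne_apply, inner_smul_left, RCLike.conj_mul, ← RCLike.ofReal_pow,
    RCLike.ofReal_re]

open scoped ComplexOrder in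
theorem exists_isPositive_tendsto_birkhoffAverage [CompleteSpace E] (U : E →ₗᵢ[𝕜] E) (v : E)
    (u : Ultrafilter ℕ) :
    ∃ K : E →L[𝕜] E, K.IsPositive ∧ ∀ x,
      Tendsto (fun N => birkhoffAverage ℝ U (fun y => ‖inner 𝕜 y x‖ ^ 2) N v) u
        (𝓝 (RCLike.re (inner 𝕜 (K x) x))) := by
  let T : ℕ → E →L[𝕜] E := fun N =>
    birkhoffAverage 𝕜 U (fun y => InnerProductSpace.rankOne 𝕜 y y) N v
  have hnorm : ∀ N, ‖T N‖ ≤ ‖v‖ * ‖v‖ := norm_birkhoffAverage_le 𝕜 fun k => by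
    rw [InnerProductSpace.norm_rankOne, norm_iterate]
  have hpos : ∀ N, (T N).IsPositive := fun N => by
    exact (ContinuousLinearMap.isPositive_sum _ fun _ _ =>
      InnerProductSpace.isPositive_rankOne_self _).smul_of_nonneg (by positivity)
  have hform : ∀ N x, RCLike.re (inner 𝕜 (T N x) x) =
      birkhoffAverage ℝ U (fun y => ‖inner 𝕜 y x‖ ^ 2) N v := fun N x => by
    have hscalar : (N : 𝕜)⁻¹ = ((N⁻¹ : ℝ) : 𝕜) := by simp
    simp only [T, birkhoffAverage, birkhoffSum, hscalar, smul_apply, sum_apply, inner_smul_left,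
      sum_inner, RCLike.conj_ofReal, RCLike.re_ofReal_mul, map_sum, re_inner_rankOne_self,
      smul_eq_mul]
  obtain ⟨K, hK⟩ := exists_weak_limit u T hnorm
  exact ⟨K, isPositive_of_tendsto_inner hpos hK, fun x =>
    ((RCLike.continuous_re.tendsto _).comp (hK x x)).congr fun N => hform N x⟩

theorem sum_norm_inner_sq_iterate_le (U : E →ₗᵢ[𝕜] E) (v : E) {n : ℕ} {e : Fin n → E}
    (he : Orthonormal 𝕜 e) (N : ℕ) :
    ∑ i, birkhoffAverage ℝ U (fun y => ‖inner 𝕜 y (e i)‖ ^ 2) N v ≤ ‖v‖ ^ 2 := by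
  have hbessel : ∀ k, ‖∑ i, ‖inner 𝕜 (U^[k] v) (e i)‖ ^ 2‖ ≤ ‖v‖ ^ 2 := fun k => by
    rw [Real.norm_of_nonneg (by positivity), ← norm_iterate U k v]
    simpa only [norm_inner_symm] using he.sum_inner_products_le (U^[k] v) (s := Finset.univ)
  refine le_trans (le_of_eq ?_) ((le_abs_self _).trans
    (norm_birkhoffAverage_le ℝ (g := fun y => ∑ i, ‖inner 𝕜 y (e i)‖ ^ 2) hbessel N))
  simp only [birkhoffAverage, birkhoffSum, ← Finset.smul_sum]
  rw [Finset.sum_comm]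

theorem tendsto_birkhoffAverage_inner_map_sub (U : E →ₗᵢ[𝕜] E) (v x : E) :
    Tendsto (fun N => birkhoffAverage ℝ U (fun y => ‖inner 𝕜 y x‖ ^ 2) N v -
      birkhoffAverage ℝ U (fun y => ‖inner 𝕜 y (U x)‖ ^ 2) N v) atTop (𝓝 0) := by
  have hshift : ∀ N, birkhoffAverage ℝ U (fun y => ‖inner 𝕜 y (U x)‖ ^ 2) N (U v) =
      birkhoffAverage ℝ U (fun y => ‖inner 𝕜 y x‖ ^ 2) N v := fun N => by
    simp only [birkhoffAverage, birkhoffSum, ← Function.iterate_succ_apply,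
      Function.iterate_succ_apply', U.inner_map_map]
  simp only [← hshift]
  refine tendsto_birkhoffAverage_apply_sub_birkhoffAverage ℝ (isBounded_iff_forall_norm_le.2
    ⟨(‖v‖ * ‖U x‖) ^ 2, Set.forall_mem_range.2 fun k => ?_⟩)
  rw [norm_pow, norm_norm, ← norm_iterate U k v]
  gcongr
  exact norm_inner_le_norm _ _

theorem isFinInvariant_eigenspace_norm [CompleteSpace E] {U : E →ₗᵢ[𝕜] E} {K : E →L[𝕜] E}
    (hc : IsCompactOperator K) (hK₀ : K ≠ 0)
    (hU : ∀ x, RCLike.re (inner 𝕜 (K (U x)) (U x)) = RCLike.re (inner 𝕜 (K x) x)) :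
    IsFinInvariant U (Module.End.eigenspace (K : Module.End 𝕜 E) (‖K‖ : 𝕜)) where
  finiteDimensional :=
    ContinuousLinearMap.finite_dimensional_eigenspace hc _ (by simpa using hK₀)
  mapsTo x hx := by
    rw [SetLike.mem_coe, mem_eigenspace_norm_iff] at hx ⊢
    rw [hU, hx, U.norm_map]

theorem tendsto_birkhoffAverage_norm_inner_sq [CompleteSpace E] (U : E →ₗᵢ[𝕜] E) {v : E}
    (hv : v ∈ (finInvariantSpan U)ᗮ) (x : E) :
    Tendsto (fun N => birkhoffAverage ℝ U (fun y => ‖inner 𝕜 y x‖ ^ 2) N v) atTop (𝓝 0) := by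
  rw [tendsto_iff_ultrafilter]
  intro u hu
  obtain ⟨K, hpos, hK⟩ := exists_isPositive_tendsto_birkhoffAverage U v u
  suffices hK₀ : K = 0 by simpa [hK₀] using hK x
  by_contra hK₀
  have hcompact : IsCompactOperator K := isCompactOperator_of_trace_le hpos fun n e he =>
    le_of_tendsto (tendsto_finsetSum _ fun i _ => hK (e i))
      (Eventually.of_forall (sum_norm_inner_sq_iterate_le U v he))
  have hinvariant : ∀ x, RCLike.re (inner 𝕜 (K (U x)) (U x)) = RCLike.re (inner 𝕜 (K x) x) :=
    fun x => (sub_eq_zero.1 (tendsto_nhds_unique ((hK x).sub (hK (U x)))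
      ((tendsto_birkhoffAverage_inner_map_sub U v x).mono_left hu))).symm
  have hF := isFinInvariant_eigenspace_norm hcompact hK₀ hinvariant
  obtain ⟨z, hz, hz₀⟩ :=
    (hasEigenvalue_norm_of_isPositive hpos hcompact hK₀).exists_hasEigenvector
  have horth : ∀ k, inner 𝕜 (U^[k] v) z = 0 := fun k => by
    have hvF := Submodule.orthogonal_le hF.le_finInvariantSpan hv
    exact (Submodule.mem_orthogonal' _ _).1 (hF.mapsTo_orthogonal.iterate k hvF) z hz
  have hzero : RCLike.re (inner 𝕜 (K z) z) = 0 :=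
    tendsto_nhds_unique (hK z) (tendsto_const_nhds.congr fun N => by
      simp [birkhoffAverage, birkhoffSum, horth])
  rw [mem_eigenspace_norm_iff.1 hz] at hzero
  simp [hK₀, hz₀] at hzero

end KoopmanVonNeumann

section Density

theorem hasDensityOne_of_ncard_compl_le {A : Set ℕ} {δ : ℕ → ℝ} (hδ : Tendsto δ atTop (𝓝 0))
    (hA : ∀ N : ℕ, ((Aᶜ ∩ Set.Iio N).ncard : ℝ) ≤ N * δ N) : HasDensityOne A := by
  have hcount : ∀ N, ((A ∩ Set.Iio N).ncard : ℝ) + (Aᶜ ∩ Set.Iio N).ncard = N := fun N => by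
    have hsplit := Set.ncard_inter_add_ncard_sdiff_eq_ncard (Set.Iio N) A
    rw [Set.inter_comm, Set.sdiff_eq, Set.inter_comm _ Aᶜ, Set.ncard_Iio_nat] at hsplit
    exact_mod_cast hsplit
  refine tendsto_of_tendsto_of_tendsto_of_le_of_le' (by simpa using hδ.const_sub 1)
    tendsto_const_nhds ?_ ?_ <;> filter_upwards [eventually_gt_atTop 0] with N hN
  · rw [le_div_iff₀ (by exact_mod_cast hN)]
    linarith [hcount N, hA N]
  · refine div_le_one_of_le₀ ?_ (by positivity)
    linarith [hcount N, (Nat.cast_nonneg _ : (0 : ℝ) ≤ (Aᶜ ∩ Set.Iio N).ncard)]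

theorem hasDensityOne_univ : HasDensityOne Set.univ :=
  hasDensityOne_of_ncard_compl_le tendsto_const_nhds (by simp)

theorem ncard_mul_le_sum {a t : ℕ → ℝ} (ha : ∀ n, 0 ≤ a n) (ht : Antitone t) (N : ℕ) :
    ({n | t n ≤ a n} ∩ Set.Iio N).ncard * t N ≤ ∑ n ∈ Finset.range N, a n := by
  classical
  have hfilter : {n | t n ≤ a n} ∩ Set.Iio N = (Finset.range N).filter fun n => t n ≤ a n := by
    ext n
    simp [and_comm]
  rw [hfilter, Set.ncard_coe_finset, ← nsmul_eq_mul]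
  refine (Finset.card_nsmul_le_sum _ a _ fun n hn => ?_).trans
    (Finset.sum_le_sum_of_subset_of_nonneg (Finset.filter_subset _ _) fun n _ _ => ha n)
  obtain ⟨hnN, htn⟩ := Finset.mem_filter.1 hn
  exact (ht (Finset.mem_range.1 hnN).le).trans htn

theorem exists_antitone_majorant {b : ℕ → ℝ} (hb : ∀ n, 0 ≤ b n) (hb₀ : Tendsto b atTop (𝓝 0)) :
    ∃ s : ℕ → ℝ, Antitone s ∧ (∀ n, 0 < s n) ∧ (∀ n, b n ≤ s n) ∧ Tendsto s atTop (𝓝 0) := by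
  have hbdd : ∀ N, BddAbove (Set.range fun m => b (N + m)) := fun N =>
    hb₀.bddAbove_range.mono (by rintro _ ⟨m, rfl⟩; exact ⟨_, rfl⟩)
  have hsup_nonneg : ∀ N, 0 ≤ ⨆ m, b (N + m) := fun N => Real.iSup_nonneg fun m => hb _
  have hsup : Tendsto (fun N => ⨆ m, b (N + m)) atTop (𝓝 0) := by
    refine tendsto_order.2 ⟨fun c hc => Eventually.of_forall fun N => hc.trans_le (hsup_nonneg N),
      fun c hc => ?_⟩
    obtain ⟨N, hN⟩ := eventually_atTop.1 (hb₀.eventually_lt_const (half_pos hc))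
    filter_upwards [eventually_ge_atTop N] with n hn
    exact (ciSup_le fun m => (hN (n + m) (by lia)).le).trans_lt (half_lt_self hc)
  refine ⟨fun N => (⨆ m, b (N + m)) + 1 / ((N : ℝ) + 1), fun M N hMN => ?_, fun N => ?_,
    fun N => ?_, by simpa only [add_zero] using hsup.add tendsto_one_div_add_atTop_nhds_zero_nat⟩
  · refine add_le_add (ciSup_le fun m => ?_) (Nat.one_div_le_one_div hMN)
    obtain ⟨k, rfl⟩ := Nat.exists_eq_add_of_le hMN
    rw [add_assoc]
    exact le_ciSup (hbdd M) (k + m)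
  · exact add_pos_of_nonneg_of_pos (hsup_nonneg N) Nat.one_div_pos_of_nat
  · exact le_add_of_le_of_nonneg (le_ciSup (hbdd N) 0) Nat.one_div_pos_of_nat.le

theorem exists_hasDensityOne_tendsto {a : ℕ → ℝ} (ha : ∀ n, 0 ≤ a n)
    (h : Tendsto (fun N : ℕ => (N : ℝ)⁻¹ * ∑ n ∈ Finset.range N, a n) atTop (𝓝 0)) :
    ∃ A, HasDensityOne A ∧ Tendsto a (atTop ⊓ 𝓟 A) (𝓝 0) := by
  obtain ⟨s, hs_anti, hs_pos, hs_major, hs⟩ := exists_antitone_majorant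
    (fun N => mul_nonneg (by positivity) (Finset.sum_nonneg fun n _ => ha n)) h
  have hsqrt : Tendsto (fun N => √(s N)) atTop (𝓝 0) := by simpa using hs.sqrt
  -- By Markov's inequality at most `N √(s N)` of the first `N` terms are at least `√(s N)`.
  refine ⟨{n | a n < √(s n)}, hasDensityOne_of_ncard_compl_le hsqrt fun N => ?_, ?_⟩
  · have hmarkov := ncard_mul_le_sum ha (Real.sqrt_monotone.comp_antitone hs_anti) N
    have hsum : ∑ n ∈ Finset.range N, a n ≤ N * s N := by
      rcases eq_or_ne N 0 with rfl | hN
      · simp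
      · exact (inv_mul_le_iff₀ (by positivity)).1 (hs_major N)
    refine le_of_mul_le_mul_right ?_ (Real.sqrt_pos.2 (hs_pos N))
    rw [mul_assoc, Real.mul_self_sqrt (hs_pos N).le, Set.compl_ofPred]
    simpa only [not_lt, Function.comp_apply] using hmarkov.trans hsum
  · refine tendsto_of_tendsto_of_tendsto_of_le_of_le' tendsto_const_nhds
      (hsqrt.mono_left inf_le_left) (Eventually.of_forall ha) ?_
    exact mem_inf_of_right (mem_principal.2 fun n (hn : a n < √(s n)) => hn.le)

theorem cesaro_le {a : ℕ → ℝ} {C : ℝ} (ha : ∀ n, 0 ≤ a n) (hC : ∀ n, a n ≤ C) (N : ℕ) :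
    (N : ℝ)⁻¹ * ∑ n ∈ Finset.range N, a n ≤ C := by
  rcases eq_or_ne N 0 with rfl | hN
  · simpa using (ha 0).trans (hC 0)
  · rw [inv_mul_le_iff₀ (by positivity)]
    exact (Finset.sum_le_card_nsmul _ _ _ fun n _ => hC n).trans_eq (by simp)

theorem tendsto_cesaro_tsum {c : ℕ → ℕ → ℝ} {g : ℕ → ℝ} (hg : Summable g)
    (hc : ∀ k n, 0 ≤ c k n) (hcg : ∀ k n, c k n ≤ g k)
    (h : ∀ k, Tendsto (fun N : ℕ => (N : ℝ)⁻¹ * ∑ n ∈ Finset.range N, c k n) atTop (𝓝 0)) :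
    Tendsto (fun N : ℕ => (N : ℝ)⁻¹ * ∑ n ∈ Finset.range N, ∑' k, c k n) atTop (𝓝 0) := by
  have hlimit : Tendsto (fun N : ℕ => ∑' k, (N : ℝ)⁻¹ * ∑ n ∈ Finset.range N, c k n)
      atTop (𝓝 (∑' _k : ℕ, (0 : ℝ))) := by
    refine tendsto_tsum_of_dominated_convergence hg h (Eventually.of_forall fun N k => ?_)
    rw [Real.norm_of_nonneg (mul_nonneg (by positivity) (Finset.sum_nonneg fun n _ => hc k n))]
    exact cesaro_le (hc k) (hcg k) N
  rw [tsum_zero] at hlimit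
  refine hlimit.congr fun N => ?_
  rw [tsum_mul_left, Summable.tsum_finsetSum fun n _ =>
    hg.of_nonneg_of_le (hc · n) (hcg · n)]

theorem exists_hasDensityOne_forall_tendsto {a : ℕ → ℕ → ℝ} {D : ℝ} (ha : ∀ k n, 0 ≤ a k n)
    (haD : ∀ k n, a k n ≤ D)
    (h : ∀ k, Tendsto (fun N : ℕ => (N : ℝ)⁻¹ * ∑ n ∈ Finset.range N, a k n) atTop (𝓝 0)) :
    ∃ A, HasDensityOne A ∧ ∀ k, Tendsto (a k) (atTop ⊓ 𝓟 A) (𝓝 0) := by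
  -- Apply the case of a single sequence to `∑ k, 2⁻ᵏ a k`.
  have hweight_nonneg : ∀ k n, 0 ≤ (1 / 2 : ℝ) ^ k * a k n := fun k n =>
    mul_nonneg (by positivity) (ha k n)
  have hweight_le : ∀ k n, (1 / 2 : ℝ) ^ k * a k n ≤ (1 / 2 : ℝ) ^ k * D := fun k n =>
    mul_le_mul_of_nonneg_left (haD k n) (by positivity)
  have hgeom : Summable fun k : ℕ => (1 / 2 : ℝ) ^ k * D := summable_geometric_two.mul_right D
  obtain ⟨A, hA, hsum⟩ := exists_hasDensityOne_tendsto
    (fun n => tsum_nonneg (hweight_nonneg · n))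
    (tendsto_cesaro_tsum hgeom hweight_nonneg hweight_le fun k => by
      simpa only [← Finset.mul_sum, mul_left_comm, mul_zero] using (h k).const_mul ((1 / 2) ^ k))
  refine ⟨A, hA, fun k => ?_⟩
  have hweight : Tendsto (fun n => (1 / 2 : ℝ) ^ k * a k n) (atTop ⊓ 𝓟 A) (𝓝 0) :=
    squeeze_zero (hweight_nonneg k) (fun n =>
      (hgeom.of_nonneg_of_le (hweight_nonneg · n) (hweight_le · n)).le_tsum k
        fun j _ => hweight_nonneg j n) hsum
  have hscaled := hweight.const_mul ((2 : ℝ) ^ k)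
  rw [mul_zero] at hscaled
  exact hscaled.congr fun n => by rw [← mul_assoc, ← mul_pow]; norm_num

end Density

section WeakConvergence

variable {𝕜 E : Type*} [RCLike 𝕜] [NormedAddCommGroup E] [InnerProductSpace 𝕜 E]

/-- The vectors to which a sequence `x` becomes orthogonal along the filter `l`. -/
def asymptoticOrthogonal (𝕜 : Type*) {E : Type*} [RCLike 𝕜] [NormedAddCommGroup E]
    [InnerProductSpace 𝕜 E] (l : Filter ℕ) (x : ℕ → E) : Submodule 𝕜 E where
  carrier := {w | Tendsto (fun n => inner 𝕜 (x n) w) l (𝓝 0)}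
  zero_mem' := by simpa using tendsto_const_nhds
  add_mem' := fun {a b} ha hb => by
    simpa [inner_add_right] using Tendsto.add (f := fun n => inner 𝕜 (x n) a) ha hb
  smul_mem' := fun c a ha => by
    simpa [inner_smul_right] using Tendsto.const_mul (f := fun n => inner 𝕜 (x n) a) c ha

theorem isClosed_asymptoticOrthogonal {l : Filter ℕ} {x : ℕ → E} {C : ℝ} (hx : ∀ n, ‖x n‖ ≤ C) :
    IsClosed (asymptoticOrthogonal 𝕜 l x : Set E) := by
  refine isClosed_of_closure_subset fun w hw => Metric.tendsto_nhds.2 fun ε hε => ?_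
  have hC : 0 ≤ C := (norm_nonneg _).trans (hx 0)
  obtain ⟨z, hz, hwz⟩ := Metric.mem_closure_iff.1 hw (ε / 2 / (C + 1)) (by positivity)
  filter_upwards [Metric.tendsto_nhds.1 hz (ε / 2) (half_pos hε)] with n hn
  rw [dist_zero_right] at hn ⊢
  rw [dist_eq_norm, lt_div_iff₀ (by positivity)] at hwz
  have hclose : ‖inner 𝕜 (x n) (w - z)‖ ≤ ‖w - z‖ * (C + 1) := by
    grw [norm_inner_le_norm, hx n, mul_comm]
    gcongr
    exact (lt_add_one C).le
  calc ‖inner 𝕜 (x n) w‖ = ‖inner 𝕜 (x n) (w - z) + inner 𝕜 (x n) z‖ := by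
        rw [inner_sub_right, sub_add_cancel]
    _ ≤ ‖inner 𝕜 (x n) (w - z)‖ + ‖inner 𝕜 (x n) z‖ := norm_add_le _ _
    _ < ε := by linarith

theorem tendsto_inner_of_forall_tendsto_inner_self [CompleteSpace E] {l : Filter ℕ} {x : ℕ → E}
    {C : ℝ} (hx : ∀ n, ‖x n‖ ≤ C)
    (h : ∀ k, Tendsto (fun n => inner 𝕜 (x n) (x k)) l (𝓝 0)) (w : E) :
    Tendsto (fun n => inner 𝕜 (x n) w) l (𝓝 0) := by
  set S := asymptoticOrthogonal 𝕜 l x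
  have hS : CompleteSpace S := (isClosed_asymptoticOrthogonal hx).completeSpace_coe
  have horth : Sᗮ ≤ S := fun z hz =>
    tendsto_const_nhds.congr fun k => ((Submodule.mem_orthogonal _ _).1 hz (x k) (h k)).symm
  have htop : S = ⊤ := by rw [← S.sup_orthogonal_of_hasOrthogonalProjection, sup_eq_left.2 horth]
  exact htop.ge (Submodule.mem_top (x := w))

theorem exists_hasDensityOne_tendsto_inner [CompleteSpace E] (U : E →ₗᵢ[𝕜] E) {v : E}
    (hv : v ∈ (finInvariantSpan U)ᗮ) :
    ∃ A, HasDensityOne A ∧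
      ∀ w, Tendsto (fun n => inner 𝕜 (U^[n] v) w) (atTop ⊓ 𝓟 A) (𝓝 0) := by
  have hbound : ∀ k n, ‖inner 𝕜 (U^[n] v) (U^[k] v)‖ ^ 2 ≤ (‖v‖ * ‖v‖) ^ 2 := fun k n => by
    grw [norm_inner_le_norm, norm_iterate, norm_iterate]
  obtain ⟨A, hA, horbit⟩ := exists_hasDensityOne_forall_tendsto (fun _ _ => sq_nonneg _) hbound
    fun k => tendsto_birkhoffAverage_norm_inner_sq U hv (U^[k] v)
  refine ⟨A, hA, tendsto_inner_of_forall_tendsto_inner_self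
    (fun n => (norm_iterate U n v).le) fun k => tendsto_zero_iff_norm_tendsto_zero.2 ?_⟩
  simpa [Real.sqrt_sq] using (horbit k).sqrt

theorem tendsto_norm_starProjection {l : Filter ℕ} {x : ℕ → E}
    (hx : ∀ w, Tendsto (fun n => inner 𝕜 (x n) w) l (𝓝 0)) (W : Submodule 𝕜 E)
    [FiniteDimensional 𝕜 W] : Tendsto (fun n => ‖W.starProjection (x n)‖) l (𝓝 0) := by
  let e := stdOrthonormalBasis 𝕜 W
  have hsum : ∀ n, W.starProjection (x n) = ∑ i, inner 𝕜 (e i : E) (x n) • (e i : E) := fun n => by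
    simp [e.starProjection_eq_sum_rankOne]
  rw [← tendsto_zero_iff_norm_tendsto_zero]
  simp_rw [hsum]
  rw [← Finset.sum_const_zero (s := (Finset.univ : Finset (Fin (Module.finrank 𝕜 W))))]
  refine tendsto_finsetSum _ fun i _ => ?_
  have hconj := (RCLike.continuous_conj.tendsto _).comp (hx (e i))
  simp only [Function.comp_def, inner_conj_symm, map_zero] at hconj
  simpa using hconj.smul_const (e i : E)

theorem norm_sub_starProjection_eq_infDist (W : Submodule 𝕜 E) [W.HasOrthogonalProjection]
    (x : E) : ‖x - W.starProjection x‖ = Metric.infDist x W := by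
  rw [W.starProjection_minimal, Metric.infDist_eq_iInf]
  simp only [dist_eq_norm]
  rfl

theorem inner_iterate_iterate (U : E →ₗᵢ[𝕜] E) (n : ℕ) (x y : E) :
    inner 𝕜 (U^[n] x) (U^[n] y) = inner 𝕜 x y := by
  induction n with
  | zero => rfl
  | succ n ih => rw [Function.iterate_succ_apply', Function.iterate_succ_apply',
      U.inner_map_map, ih]

theorem norm_sq_le_infDist_mul_norm_add (W : Submodule 𝕜 E) [W.HasOrthogonalProjection] {x b : E}
    (hxb : inner 𝕜 (x - b) b = 0) :
    ‖b‖ ^ 2 ≤ Metric.infDist x W * ‖b‖ + ‖x‖ * ‖W.starProjection b‖ := by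
  have hinner : inner 𝕜 b b =
      inner 𝕜 (x - W.starProjection x) b + inner 𝕜 x (W.starProjection b) := by
    rw [inner_sub_left, Submodule.inner_starProjection_left_eq_right, sub_add_cancel]
    rwa [inner_sub_left, sub_eq_zero, eq_comm] at hxb
  calc ‖b‖ ^ 2 = ‖inner 𝕜 b b‖ := by simp [inner_self_eq_norm_sq_to_K]
    _ ≤ ‖x - W.starProjection x‖ * ‖b‖ + ‖x‖ * ‖W.starProjection b‖ := by
      rw [hinner]
      exact (norm_add_le _ _).trans (add_le_add (norm_inner_le_norm _ _) (norm_inner_le_norm _ _))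
    _ = _ := by rw [norm_sub_starProjection_eq_infDist]

theorem eventually_lt_infDist_iterate (U : E →ₗᵢ[𝕜] E) {l : Filter ℕ} {x b : E}
    (hxb : inner 𝕜 (x - b) b = 0)
    (hb : ∀ w, Tendsto (fun n => inner 𝕜 (U^[n] b) w) l (𝓝 0)) (W : Submodule 𝕜 E)
    [FiniteDimensional 𝕜 W] {η : ℝ} (hη : 0 < η) :
    ∀ᶠ n in l, ‖b‖ - η < Metric.infDist (U^[n] x) W := by
  rcases eq_or_ne b 0 with rfl | hb₀
  · exact Eventually.of_forall fun n => (by simpa using hη : ‖(0 : E)‖ - η < 0).trans_le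
      Metric.infDist_nonneg
  have hnorm : 0 < ‖b‖ := norm_pos_iff.2 hb₀
  have hproj : Tendsto (fun n => ‖x‖ * ‖W.starProjection (U^[n] b)‖) l (𝓝 0) := by
    simpa using (tendsto_norm_starProjection hb W).const_mul ‖x‖
  filter_upwards [hproj.eventually_lt_const (mul_pos hη hnorm)] with n hn
  have horth : inner 𝕜 (U^[n] x - U^[n] b) (U^[n] b) = 0 := by
    rw [inner_sub_left, inner_iterate_iterate, inner_iterate_iterate, ← inner_sub_left, hxb]
  have hle := norm_sq_le_infDist_mul_norm_add W horth
  rw [norm_iterate, norm_iterate] at hle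
  nlinarith

end WeakConvergence

section Transfer

theorem infDist_le_infDist_of_mapsTo {α β : Type*} [PseudoMetricSpace α] [PseudoMetricSpace β]
    {T : α → β} (hT : LipschitzWith 1 T) {s : Set α} {t : Set β} (hst : Set.MapsTo T s t)
    (hs : s.Nonempty) (x : α) : Metric.infDist (T x) t ≤ Metric.infDist x s :=
  (Metric.le_infDist hs).2 fun y hy => by
    grw [Metric.infDist_le_dist_of_mem (hst hy), hT.dist_le_mul, NNReal.coe_one, one_mul]

variable {𝕜 E : Type*} [RCLike 𝕜] [NormedAddCommGroup E] [InnerProductSpace 𝕜 E]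

theorem IsFinInvariant.infDist_iterate_le {U : E →ₗᵢ[𝕜] E} {F W : Submodule 𝕜 E}
    (hF : IsFinInvariant U F) (hFW : F ≤ W) (n : ℕ) (x : E) :
    Metric.infDist (U^[n] x) W ≤ Metric.infDist x F := by
  rw [← hF.infDist_iterate n x]
  exact Metric.infDist_le_infDist_of_subset hFW F.nonempty

theorem IsFinInvariant.exists_le_infDist_lt {U : E →ₗᵢ[𝕜] E} {G : Submodule 𝕜 E}
    (hG : IsFinInvariant U G) {x : E} {r : ℝ} (h : Metric.infDist x (compactSubspace U) < r) :
    ∃ F, IsFinInvariant U F ∧ G ≤ F ∧ Metric.infDist x F < r := by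
  rw [Submodule.topologicalClosure_coe, Metric.infDist_closure,
    Metric.infDist_lt_iff (finInvariantSpan U).nonempty] at h
  obtain ⟨y, ⟨F, hF, hy⟩, hxy⟩ := h
  exact ⟨F ⊔ G, hF.sup hG, le_sup_right,
    (Metric.infDist_le_dist_of_mem (Submodule.mem_sup_left hy)).trans_lt hxy⟩

variable [NormedSpace ℝ E] [IsScalarTower ℝ 𝕜 E] {𝕜' E' : Type*} [RCLike 𝕜']
  [NormedAddCommGroup E'] [InnerProductSpace 𝕜' E'] [NormedSpace ℝ E'] [IsScalarTower ℝ 𝕜' E']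

theorem IsFinInvariant.span_image {U : E →ₗᵢ[𝕜] E} {U' : E' →ₗᵢ[𝕜'] E'} {T : E →L[ℝ] E'}
    (hT : ∀ x, T (U x) = U' (T x)) {F : Submodule 𝕜 E} (hF : IsFinInvariant U F) :
    IsFinInvariant U' (Submodule.span 𝕜' (T '' F)) where
  finiteDimensional := by
    have := hF.finiteDimensional
    have hFℝ : FiniteDimensional ℝ (F.restrictScalars ℝ) := FiniteDimensional.trans ℝ 𝕜 F
    obtain ⟨s, hs⟩ := Module.Finite.iff_fg.1
      (inferInstance : FiniteDimensional ℝ ((F.restrictScalars ℝ).map T.toLinearMap))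
    have himage : T '' F = Submodule.span ℝ (s : Set E') := by rw [hs]; rfl
    rw [himage, Submodule.span_span_of_tower]
    infer_instance
  mapsTo := by
    have hle : Submodule.span 𝕜' (T '' F) ≤
        (Submodule.span 𝕜' (T '' F)).comap U'.toLinearMap := by
      refine Submodule.span_le.2 ?_
      rintro _ ⟨z, hz, rfl⟩
      exact Submodule.subset_span ⟨U z, hF.mapsTo hz, hT z⟩
    exact hle

theorem mapsTo_compactSubspace {U : E →ₗᵢ[𝕜] E} {U' : E' →ₗᵢ[𝕜'] E'} {T : E →L[ℝ] E'}
    (hT : ∀ x, T (U x) = U' (T x)) : Set.MapsTo T (compactSubspace U) (compactSubspace U') := by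
  refine Set.MapsTo.closure ?_ T.continuous
  rintro x ⟨F, hF, hx⟩
  exact ⟨_, hF.span_image hT, Submodule.subset_span ⟨x, hx, rfl⟩⟩

end Transfer

section Eigenvectors

theorem eq_of_inf_orthogonal_eq_bot {𝕜 E : Type*} [RCLike 𝕜] [NormedAddCommGroup E]
    [InnerProductSpace 𝕜 E] {F G : Submodule 𝕜 E} [G.HasOrthogonalProjection] (hGF : G ≤ F)
    (h : F ⊓ Gᗮ = ⊥) : G = F := by
  rw [← Submodule.sup_orthogonal_inf_of_hasOrthogonalProjection hGF, inf_comm, h, sup_bot_eq]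

variable {E : Type*} [NormedAddCommGroup E] [InnerProductSpace ℂ E]

theorem isFinInvariant_span_singleton {U : E →ₗᵢ[ℂ] E} {c : ℂ} {v : E}
    (hv : Module.End.HasEigenvector U.toLinearMap c v) :
    IsFinInvariant U (Submodule.span ℂ {v}) where
  finiteDimensional := inferInstance
  mapsTo x hx := by
    obtain ⟨a, rfl⟩ := Submodule.mem_span_singleton.1 hx
    have hUv : U v = c • v := hv.apply_eq_smul
    rw [map_smul, hUv]
    exact Submodule.smul_mem _ _ (Submodule.smul_mem _ _ (Submodule.mem_span_singleton_self v))

theorem IsFinInvariant.exists_hasEigenvector {U : E →ₗᵢ[ℂ] E} {F : Submodule ℂ E}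
    (hF : IsFinInvariant U F) (hne : F ≠ ⊥) :
    ∃ v ∈ F, ∃ c, Module.End.HasEigenvector U.toLinearMap c v := by
  have := hF.finiteDimensional
  have := Submodule.nontrivial_iff_ne_bot.2 hne
  obtain ⟨c, hc⟩ := Module.End.exists_eigenvalue (U.toLinearMap.restrict hF.mapsTo)
  obtain ⟨v, hv⟩ := hc.exists_hasEigenvector
  exact ⟨v, v.2, c, Module.End.mem_eigenspace_iff.2 (congrArg Subtype.val hv.apply_eq_smul),
    fun h => hv.2 (Subtype.ext h)⟩

theorem span_eigenvectors_eq_finInvariantSpan (U : E →ₗᵢ[ℂ] E) :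
    Submodule.span ℂ {v : E | ∃ c : ℂ, Module.End.HasEigenvector U.toLinearMap c v} =
      finInvariantSpan U := by
  set S := Submodule.span ℂ {v : E | ∃ c : ℂ, Module.End.HasEigenvector U.toLinearMap c v}
  refine le_antisymm (Submodule.span_le.2 ?_) ?_
  · rintro v ⟨c, hv⟩
    exact (isFinInvariant_span_singleton hv).le_finInvariantSpan
      (Submodule.mem_span_singleton_self v)
  · rintro x ⟨F, hF, hx⟩
    have := hF.finiteDimensional
    have hS : S ≤ S.comap U.toLinearMap := Submodule.span_le.2 fun v ⟨c, hv⟩ => by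
      rw [SetLike.mem_coe, Submodule.mem_comap, hv.apply_eq_smul]
      exact S.smul_mem c (Submodule.subset_span ⟨c, hv⟩)
    have hFS : IsFinInvariant U (F ⊓ S) := ⟨inferInstance, fun _ hy => ⟨hF.mapsTo hy.1, hS hy.2⟩⟩
    have hbot : F ⊓ (F ⊓ S)ᗮ = ⊥ := by
      by_contra hne
      obtain ⟨v, ⟨hvF, hvorth⟩, c, hv⟩ := (hF.inf_orthogonal hFS).exists_hasEigenvector hne
      exact hv.2 (inner_self_eq_zero.1 (hvorth v ⟨hvF, Submodule.subset_span ⟨c, hv⟩⟩))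
    exact inf_eq_left.1 (eq_of_inf_orthogonal_eq_bot inf_le_left hbot) hx

end Eigenvectors

section Koopman

variable {M : Type*} [MeasurableSpace M] {μ : Measure M} {f : M → M}

/-- The Koopman operator `koopman` as a linear isometry. -/
noncomputable abbrev koopmanIsometry (𝕜 E : Type*) [RCLike 𝕜] [NormedAddCommGroup E]
    [NormedSpace 𝕜 E] (hf : MeasurePreserving f μ μ) : Lp E 2 μ →ₗᵢ[𝕜] Lp E 2 μ :=
  Lp.compMeasurePreservingₗᵢ 𝕜 f hf

theorem koopman_pow_apply (𝕜 E : Type*) [RCLike 𝕜] [NormedAddCommGroup E] [NormedSpace 𝕜 E]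
    (hf : MeasurePreserving f μ μ) (n : ℕ) (x : Lp E 2 μ) :
    (koopman 𝕜 E hf ^ n) x = (koopmanIsometry 𝕜 E hf)^[n] x :=
  Module.End.pow_apply _ _ _

theorem koopmanIsometry_iterate (𝕜 : Type*) {E : Type*} [RCLike 𝕜] [NormedAddCommGroup E]
    [NormedSpace 𝕜 E] (hf : MeasurePreserving f μ μ) (n : ℕ) :
    (koopmanIsometry 𝕜 E hf)^[n] = Lp.compMeasurePreserving f^[n] (hf.iterate n) :=
  Lp.compMeasurePreserving_iterate hf n

theorem compLp_koopmanIsometry (𝕜 𝕜' : Type*) {E F : Type*} [RCLike 𝕜] [RCLike 𝕜']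
    [NormedAddCommGroup E] [NormedSpace ℝ E] [NormedSpace 𝕜 E] [NormedAddCommGroup F]
    [NormedSpace ℝ F] [NormedSpace 𝕜' F] (hf : MeasurePreserving f μ μ) (T : E →L[ℝ] F)
    (g : Lp E 2 μ) :
    T.compLp (koopmanIsometry 𝕜 E hf g) = koopmanIsometry 𝕜' F hf (T.compLp g) := by
  apply Lp.ext
  filter_upwards [T.coeFn_compLp (koopmanIsometry 𝕜 E hf g), Lp.coeFn_compMeasurePreserving g hf,
    Lp.coeFn_compMeasurePreserving (T.compLp g) hf,
    hf.quasiMeasurePreserving.ae (T.coeFn_compLp g)] with x hTU hU hUT hT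
  exact hTU.trans ((congrArg T hU).trans (hUT.trans hT).symm)

theorem koopmanIsometry_const (𝕜 : Type*) {E : Type*} [RCLike 𝕜] [NormedAddCommGroup E]
    [NormedSpace 𝕜 E] [IsFiniteMeasure μ] (hf : MeasurePreserving f μ μ) (c : E) :
    koopmanIsometry 𝕜 E hf (Lp.const 2 μ c) = Lp.const 2 μ c := by
  rw [← MemLp.toLp_const]
  exact Lp.toLp_compMeasurePreserving _ hf

theorem discreteSubspace_eq_compactSubspace (E : Type*) [NormedAddCommGroup E]
    [InnerProductSpace ℂ E] (hf : MeasurePreserving f μ μ) :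
    discreteSubspace E hf = compactSubspace (koopmanIsometry ℂ E hf) :=
  congrArg Submodule.topologicalClosure
    (span_eigenvectors_eq_finInvariantSpan (koopmanIsometry ℂ E hf))

end Koopman

section Scalars

variable {d : ℕ}

/-- The coordinatewise map `z ↦ re z` from `𝕜^d` to `𝕜'^d`. As a map between any two of the scalar
fields it fixes real vectors and shrinks distances, which makes it serve both as the inclusion
`ℝ^d → ℂ^d` and as the real part `ℂ^d → ℝ^d`. -/
noncomputable def reVec (𝕜 𝕜' : Type*) [RCLike 𝕜] [RCLike 𝕜'] (d : ℕ) :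
    EuclideanSpace 𝕜 (Fin d) →L[ℝ] EuclideanSpace 𝕜' (Fin d) where
  toFun x := ofRealVec 𝕜' (WithLp.toLp 2 fun i => RCLike.re (x i))
  map_add' x y := by ext i; simp [ofRealVec]
  map_smul' c x := by ext i; simp [ofRealVec, RCLike.real_smul_eq_coe_mul]
  cont := (continuous_ofRealVec 𝕜').comp <| (PiLp.continuous_toLp 2 _).comp <|
    continuous_pi fun i => RCLike.continuous_re.comp (PiLp.continuous_apply 2 _ i)

theorem lipschitzWith_reVec (𝕜 𝕜' : Type*) [RCLike 𝕜] [RCLike 𝕜'] :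
    LipschitzWith 1 (reVec 𝕜 𝕜' d) := by
  refine AddMonoidHomClass.lipschitz_of_bound_nnnorm _ 1 fun x => ?_
  rw [one_mul, ← NNReal.coe_le_coe, coe_nnnorm, coe_nnnorm, EuclideanSpace.norm_eq,
    EuclideanSpace.norm_eq]
  gcongr with i
  simpa [reVec, ofRealVec] using RCLike.abs_re_le_norm (x i)

theorem reVec_ofRealVec (𝕜 𝕜' : Type*) [RCLike 𝕜] [RCLike 𝕜'] (x : EuclideanSpace ℝ (Fin d)) :
    reVec 𝕜 𝕜' d (ofRealVec 𝕜 x) = ofRealVec 𝕜' x := by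
  ext i
  simp [reVec, ofRealVec]

theorem reVec_real (𝕜 : Type*) [RCLike 𝕜] (x : EuclideanSpace ℝ (Fin d)) :
    reVec ℝ 𝕜 d x = ofRealVec 𝕜 x := rfl

theorem norm_ofRealVec (𝕜 : Type*) [RCLike 𝕜] (x : EuclideanSpace ℝ (Fin d)) :
    ‖ofRealVec 𝕜 x‖ = ‖x‖ := by
  simp [EuclideanSpace.norm_eq, ofRealVec]

end Scalars

section Constants

variable {M : Type*} [MeasurableSpace M] {μ : Measure M} [IsProbabilityMeasure μ] {f : M → M}
  {𝕜 E : Type*} [RCLike 𝕜] [NormedAddCommGroup E] [InnerProductSpace 𝕜 E]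

/-- The subspace of constant functions in `L²(μ; E)`. -/
noncomputable def constSubspace (μ : Measure M) [IsFiniteMeasure μ] (𝕜 E : Type*) [RCLike 𝕜]
    [NormedAddCommGroup E] [NormedSpace 𝕜 E] : Submodule 𝕜 (Lp E 2 μ) :=
  LinearMap.range (Lp.constₗ 2 μ 𝕜 : E →ₗ[𝕜] Lp E 2 μ)

theorem const_mem_constSubspace (c : E) : Lp.const 2 μ c ∈ constSubspace μ 𝕜 E := ⟨c, rfl⟩

instance [FiniteDimensional 𝕜 E] : FiniteDimensional 𝕜 (constSubspace μ 𝕜 E) := by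
  unfold constSubspace
  infer_instance

theorem isFinInvariant_constSubspace [FiniteDimensional 𝕜 E] (hf : MeasurePreserving f μ μ) :
    IsFinInvariant (koopmanIsometry 𝕜 E hf) (constSubspace μ 𝕜 E) where
  finiteDimensional := inferInstance
  mapsTo := by
    rintro _ ⟨c, rfl⟩
    exact ⟨c, (koopmanIsometry_const 𝕜 hf c).symm⟩

theorem inner_const_left [NormedSpace ℝ E] [CompleteSpace E] (c : E) (g : Lp E 2 μ) :
    inner 𝕜 (Lp.const 2 μ c) g = inner 𝕜 c (∫ x, g x ∂μ) := by
  rw [L2.inner_def, ← integral_inner ((Lp.memLp g).integrable one_le_two)]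
  refine integral_congr_ae ?_
  filter_upwards [Lp.coeFn_const (p := 2) (μ := μ) (c := c)] with x hx
  rw [hx]
  rfl

theorem starProjection_constSubspace [NormedSpace ℝ E] [CompleteSpace E]
    [(constSubspace μ 𝕜 E).HasOrthogonalProjection] (g : Lp E 2 μ) :
    (constSubspace μ 𝕜 E).starProjection g = Lp.const 2 μ (∫ x, g x ∂μ) := by
  refine Submodule.eq_starProjection_of_mem_of_inner_eq_zero (const_mem_constSubspace _) ?_
  rintro _ ⟨c, rfl⟩
  have hmean : ∫ x, Lp.const 2 μ (∫ x, g x ∂μ) x ∂μ = ∫ x, g x ∂μ := by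
    rw [integral_congr_ae (Lp.coeFn_const 2 μ _)]
    simp
  rw [inner_eq_zero_symm, inner_sub_right, sub_eq_zero]
  change inner 𝕜 (Lp.const 2 μ c) g = inner 𝕜 (Lp.const 2 μ c) _
  rw [inner_const_left, inner_const_left, hmean]

end Constants

section Observable

variable {M : Type*} [TopologicalSpace M] [SecondCountableTopology M] [MeasurableSpace M]
  [BorelSpace M] {μ : Measure M} [IsProbabilityMeasure μ] {d : ℕ} {f : M → M}
  {φ : M → EuclideanSpace ℝ (Fin d)}

theorem coeFn_obsL2 (𝕜 : Type*) [RCLike 𝕜] (hμ : IsCompact μ.support) (hφ : Continuous φ) :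
    obsL2 𝕜 hμ hφ =ᵐ[μ] fun x => ofRealVec 𝕜 (φ x) :=
  MemLp.coeFn_toLp _

theorem koopmanIsometry_iterate_obsL2 (𝕜 : Type*) [RCLike 𝕜] (hμ : IsCompact μ.support)
    (hφ : Continuous φ) (hf : MeasurePreserving f μ μ) (n : ℕ) :
    (koopmanIsometry 𝕜 (EuclideanSpace 𝕜 (Fin d)) hf)^[n] (obsL2 𝕜 hμ hφ) =ᵐ[μ]
      fun x => ofRealVec 𝕜 (φ (f^[n] x)) := by
  rw [koopmanIsometry_iterate]
  exact (Lp.coeFn_compMeasurePreserving _ (hf.iterate n)).trans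
    ((hf.iterate n).quasiMeasurePreserving.ae_eq (coeFn_obsL2 𝕜 hμ hφ))

theorem compLpL_reVec_obsL2 (𝕜 𝕜' : Type*) [RCLike 𝕜] [RCLike 𝕜'] (hμ : IsCompact μ.support)
    (hφ : Continuous φ) : (reVec 𝕜 𝕜' d).compLpL 2 μ (obsL2 𝕜 hμ hφ) = obsL2 𝕜' hμ hφ := by
  apply Lp.ext
  filter_upwards [(reVec 𝕜 𝕜' d).coeFn_compLpL (obsL2 𝕜 hμ hφ), coeFn_obsL2 𝕜 hμ hφ,
    coeFn_obsL2 𝕜' hμ hφ] with x hre hx hx'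
  rw [hre, hx, hx', reVec_ofRealVec]

theorem infDist_compactSubspace_obsL2_le (𝕜 𝕜' : Type*) [RCLike 𝕜] [RCLike 𝕜']
    (hμ : IsCompact μ.support) (hφ : Continuous φ) (hf : MeasurePreserving f μ μ) :
    Metric.infDist (obsL2 𝕜' hμ hφ)
        (compactSubspace (koopmanIsometry 𝕜' (EuclideanSpace 𝕜' (Fin d)) hf)) ≤
      Metric.infDist (obsL2 𝕜 hμ hφ)
        (compactSubspace (koopmanIsometry 𝕜 (EuclideanSpace 𝕜 (Fin d)) hf)) := by
  rw [← compLpL_reVec_obsL2 𝕜 𝕜' hμ hφ]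
  exact infDist_le_infDist_of_mapsTo ((lipschitzWith_reVec 𝕜 𝕜').lipschitzWith_compLp (map_zero _))
    (mapsTo_compactSubspace (T := (reVec 𝕜 𝕜' d).compLpL 2 μ)
      (compLp_koopmanIsometry 𝕜 𝕜' hf (reVec 𝕜 𝕜' d)))
    (Submodule.nonempty _) _

theorem mixingResidual_eq_infDist (𝕜 : Type*) [RCLike 𝕜] (hμ : IsCompact μ.support)
    (hφ : Continuous φ) (hf : MeasurePreserving f μ μ) :
    mixingResidual hμ hφ hf = Metric.infDist (obsL2 𝕜 hμ hφ)
      (compactSubspace (koopmanIsometry 𝕜 (EuclideanSpace 𝕜 (Fin d)) hf)) := by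
  rw [mixingResidual, norm_sub_starProjection_eq_infDist, discreteSubspace_eq_compactSubspace]
  exact (infDist_compactSubspace_obsL2_le 𝕜 ℂ hμ hφ hf).antisymm
    (infDist_compactSubspace_obsL2_le ℂ 𝕜 hμ hφ hf)

theorem integral_obsL2 (𝕜 : Type*) [RCLike 𝕜] (hμ : IsCompact μ.support) (hφ : Continuous φ) :
    ∫ x, obsL2 𝕜 hμ hφ x ∂μ = ofRealVec 𝕜 (∫ x, φ x ∂μ) := by
  rw [integral_congr_ae (coeFn_obsL2 𝕜 hμ hφ)]
  exact (reVec ℝ 𝕜 d).integral_comp_comm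
    ((memLp_of_isCompact_support hμ hφ).integrable one_le_two)

theorem infDist_constSubspace_obsL2 (𝕜 : Type*) [RCLike 𝕜] (hμ : IsCompact μ.support)
    (hφ : Continuous φ) :
    Metric.infDist (obsL2 𝕜 hμ hφ) (constSubspace μ 𝕜 (EuclideanSpace 𝕜 (Fin d))) =
      stdDev μ φ := by
  rw [← norm_sub_starProjection_eq_infDist, starProjection_constSubspace, integral_obsL2,
    Lp.norm_def, stdDev]
  congr 1
  refine eLpNorm_congr_norm_ae ?_
  filter_upwards [Lp.coeFn_sub (obsL2 𝕜 hμ hφ) (Lp.const 2 μ (ofRealVec 𝕜 (∫ x, φ x ∂μ))),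
    Lp.coeFn_const (p := 2) (μ := μ) (c := ofRealVec 𝕜 (∫ x, φ x ∂μ)),
    coeFn_obsL2 𝕜 hμ hφ] with x hsub hconst hobs
  rw [hsub, Pi.sub_apply, hconst, hobs, Function.const_apply, ← reVec_real, ← reVec_real,
    ← map_sub, reVec_real, norm_ofRealVec]

end Observable

section Mixing

theorem asymptoticOrthogonal_eq_top {𝕜 E : Type*} [RCLike 𝕜] [NormedAddCommGroup E]
    [InnerProductSpace 𝕜 E] {l : Filter ℕ} {x : ℕ → E} {C : ℝ} (hx : ∀ n, ‖x n‖ ≤ C) {S : Set E}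
    (hS : (Submodule.span 𝕜 S).topologicalClosure = ⊤)
    (h : ∀ s ∈ S, Tendsto (fun n => inner 𝕜 (x n) s) l (𝓝 0)) :
    asymptoticOrthogonal 𝕜 l x = ⊤ :=
  top_le_iff.1 <| hS.ge.trans <| Submodule.topologicalClosure_minimal _ (Submodule.span_le.2 h)
    (isClosed_asymptoticOrthogonal hx)

theorem tendsto_inner_of_dense_span {𝕜 E : Type*} [RCLike 𝕜] [NormedAddCommGroup E]
    [InnerProductSpace 𝕜 E] [CompleteSpace E] {l : Filter ℕ} {R : ℕ → E →L[𝕜] E} {C : ℝ}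
    (hR : ∀ n, ‖R n‖ ≤ C) {S : Set E} (hS : (Submodule.span 𝕜 S).topologicalClosure = ⊤)
    (h : ∀ s ∈ S, ∀ t ∈ S, Tendsto (fun n => inner 𝕜 (R n s) t) l (𝓝 0)) (x y : E) :
    Tendsto (fun n => inner 𝕜 (R n x) y) l (𝓝 0) := by
  have hS_left : ∀ s ∈ S, Tendsto (fun n => inner 𝕜 (R n s) y) l (𝓝 0) := fun s hs =>
    (asymptoticOrthogonal_eq_top (fun n => (R n).le_of_opNorm_le (hR n) s) hS (h s hs)).ge
      (Submodule.mem_top (x := y))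
  have hadjoint : Tendsto (fun n => inner 𝕜 ((R n).adjoint y) x) l (𝓝 0) := by
    refine (asymptoticOrthogonal_eq_top (C := C * ‖y‖) (fun n => ?_) hS fun s hs => ?_).ge
      (Submodule.mem_top (x := x))
    · exact ContinuousLinearMap.le_of_opNorm_le _ (by grw [LinearIsometryEquiv.norm_map, hR n]) y
    · have hconj := (RCLike.continuous_conj.tendsto _).comp (hS_left s hs)
      simpa only [Function.comp_def, inner_conj_symm, map_zero,
        ContinuousLinearMap.adjoint_inner_left] using hconj
  have hconj := (RCLike.continuous_conj.tendsto _).comp hadjoint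
  simpa only [Function.comp_def, inner_conj_symm, map_zero,
    ContinuousLinearMap.adjoint_inner_left] using hconj

variable {M : Type*} [MeasurableSpace M] {μ : Measure M} {f : M → M}

theorem topologicalClosure_span_indicatorConstLp [IsFiniteMeasure μ] (𝕜 E : Type*) [RCLike 𝕜]
    [NormedAddCommGroup E] [NormedSpace 𝕜 E] :
    (Submodule.span 𝕜 {x : Lp E 2 μ | ∃ (A : Set M) (hA : MeasurableSet A) (c : E),
      x = indicatorConstLp 2 hA (measure_ne_top μ A) c}).topologicalClosure = ⊤ := by
  set S := Submodule.span 𝕜 {x : Lp E 2 μ | ∃ (A : Set M) (hA : MeasurableSet A) (c : E),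
    x = indicatorConstLp 2 hA (measure_ne_top μ A) c}
  refine eq_top_iff.2 fun x _ => ?_
  refine Lp.induction (by norm_num) (motive := fun x => x ∈ S.topologicalClosure)
    (fun c A hA hAμ => ?_) (fun g k hg hk _ => Submodule.add_mem _)
    S.isClosed_topologicalClosure x
  rw [Lp.simpleFunc.coe_indicatorConst]
  exact S.le_topologicalClosure (Submodule.subset_span ⟨A, hA, c, rfl⟩)

variable [IsProbabilityMeasure μ]

section Strong

variable {𝕜 E : Type*} [RCLike 𝕜] [NormedAddCommGroup E] [InnerProductSpace 𝕜 E]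

theorem constSubspace_le_compactSubspace [FiniteDimensional 𝕜 E] (hf : MeasurePreserving f μ μ) :
    constSubspace μ 𝕜 E ≤ compactSubspace (koopmanIsometry 𝕜 E hf) :=
  (isFinInvariant_constSubspace hf).le_finInvariantSpan.trans (Submodule.le_topologicalClosure _)

theorem inner_koopmanIsometry_iterate_indicatorConstLp [CompleteSpace E]
    (hf : MeasurePreserving f μ μ) (n : ℕ) {A B : Set M} (hA : MeasurableSet A)
    (hB : MeasurableSet B) (a b : E) :
    inner 𝕜 ((koopmanIsometry 𝕜 E hf)^[n] (indicatorConstLp 2 hB (measure_ne_top μ B) b))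
      (indicatorConstLp 2 hA (measure_ne_top μ A) a) =
      μ.real (A ∩ f^[n] ⁻¹' B) • inner 𝕜 b a := by
  rw [koopmanIsometry_iterate, Lp.indicatorConstLp_compMeasurePreserving,
    L2.inner_indicatorConstLp_indicatorConstLp, Set.inter_comm]

variable [NormedSpace ℝ E] [IsScalarTower ℝ 𝕜 E]

theorem inner_starProjection_constSubspace_indicatorConstLp [CompleteSpace E]
    [(constSubspace μ 𝕜 E).HasOrthogonalProjection] {A B : Set M} (hA : MeasurableSet A)
    (hB : MeasurableSet B) (a b : E) :
    inner 𝕜 ((constSubspace μ 𝕜 E).starProjection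
        (indicatorConstLp 2 hB (measure_ne_top μ B) b))
      (indicatorConstLp 2 hA (measure_ne_top μ A) a) =
      (μ.real A * μ.real B) • inner 𝕜 b a := by
  rw [starProjection_constSubspace, inner_const_left, integral_indicatorConstLp,
    integral_indicatorConstLp, inner_smul_left_eq_smul, inner_smul_right_eq_smul, smul_smul,
    mul_comm]

theorem IsStronglyMixing.tendsto_inner [FiniteDimensional 𝕜 E] (hmix : IsStronglyMixing μ f)
    (hf : MeasurePreserving f μ μ) {v : Lp E 2 μ} (hv : v ∈ (constSubspace μ 𝕜 E)ᗮ)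
    (w : Lp E 2 μ) :
    Tendsto (fun n => inner 𝕜 ((koopmanIsometry 𝕜 E hf)^[n] v) w) atTop (𝓝 0) := by
  have := FiniteDimensional.complete 𝕜 E
  set U := koopmanIsometry 𝕜 E hf
  set P := (constSubspace μ 𝕜 E).starProjection
  let R : ℕ → Lp E 2 μ →L[𝕜] Lp E 2 μ := fun n => U.toContinuousLinearMap ^ n - P
  have hR : ∀ n z, R n z = U^[n] z - P z := fun n z => by
    rw [← U.coe_toContinuousLinearMap, ← FunLike.coe_pow_eq_iterate]
    rfl
  have hbound : ∀ n, ‖R n‖ ≤ 2 := fun n =>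
    ContinuousLinearMap.opNorm_le_bound _ zero_le_two fun z => by
      rw [hR]
      grw [norm_sub_le, norm_iterate, Submodule.norm_starProjection_apply_le]
      exact (two_mul _).ge
  have hlim := tendsto_inner_of_dense_span hbound (topologicalClosure_span_indicatorConstLp 𝕜 E)
    (l := atTop) ?_ v w
  · simpa only [hR, (Submodule.starProjection_apply_eq_zero_iff _).2 hv, P, sub_zero] using hlim
  rintro _ ⟨B, hB, b, rfl⟩ _ ⟨A, hA, a, rfl⟩
  have hcorr : Tendsto (fun n => μ.real (A ∩ f^[n] ⁻¹' B)) atTop (𝓝 (μ.real A * μ.real B)) := by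
    rw [Measure.real, Measure.real, ← ENNReal.toReal_mul]
    exact (ENNReal.tendsto_toReal (ENNReal.mul_ne_top
      (measure_ne_top μ A) (measure_ne_top μ B))).comp (hmix A B hA hB)
  have hsub := (hcorr.sub_const (μ.real A * μ.real B)).smul_const (inner 𝕜 b a)
  rw [sub_self, zero_smul] at hsub
  refine hsub.congr fun n => ?_
  rw [hR, inner_sub_left, inner_koopmanIsometry_iterate_indicatorConstLp,
    inner_starProjection_constSubspace_indicatorConstLp, sub_smul]

theorem IsStronglyMixing.compactSubspace_eq [FiniteDimensional 𝕜 E]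
    (hmix : IsStronglyMixing μ f) (hf : MeasurePreserving f μ μ) :
    compactSubspace (koopmanIsometry 𝕜 E hf) = constSubspace μ 𝕜 E := by
  set U := koopmanIsometry 𝕜 E hf
  have hconst := isFinInvariant_constSubspace (𝕜 := 𝕜) (E := E) hf
  refine le_antisymm (Submodule.topologicalClosure_minimal _ ?_
    (constSubspace μ 𝕜 E).closed_of_finiteDimensional) (constSubspace_le_compactSubspace hf)
  rintro x ⟨F, hF, hx⟩
  have hFG := hF.sup hconst
  have horth := hFG.inf_orthogonal hconst
  have := horth.finiteDimensional
  -- A weakly null orbit inside a finite-dimensional space converges to zero in norm.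
  have hbot : (F ⊔ constSubspace μ 𝕜 E) ⊓ (constSubspace μ 𝕜 E)ᗮ = ⊥ := by
    refine (Submodule.eq_bot_iff _).2 fun v hv => norm_eq_zero.1 ?_
    refine tendsto_nhds_unique (tendsto_const_nhds.congr fun n => ?_)
      (tendsto_norm_starProjection (hmix.tendsto_inner hf hv.2)
        ((F ⊔ constSubspace μ 𝕜 E) ⊓ (constSubspace μ 𝕜 E)ᗮ))
    rw [Submodule.starProjection_eq_self_iff.2 (horth.mapsTo.iterate n hv), norm_iterate]
  rw [eq_of_inf_orthogonal_eq_bot le_sup_right hbot]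
  exact Submodule.mem_sup_left hx

theorem exists_hasDensityOne_eventually_lt_infDist [FiniteDimensional 𝕜 E]
    (hf : MeasurePreserving f μ μ) (u : Lp E 2 μ) :
    ∃ A, HasDensityOne A ∧ (IsStronglyMixing μ f → A = Set.univ) ∧
      ∀ (W : Submodule 𝕜 (Lp E 2 μ)) [FiniteDimensional 𝕜 W] {η : ℝ}, 0 < η →
        ∀ᶠ n in atTop ⊓ 𝓟 A, Metric.infDist u (compactSubspace (koopmanIsometry 𝕜 E hf)) - η <
          Metric.infDist ((koopmanIsometry 𝕜 E hf)^[n] u) W := by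
  have := FiniteDimensional.complete 𝕜 E
  set U := koopmanIsometry 𝕜 E hf
  set K := compactSubspace U
  have hconst : constSubspace μ 𝕜 E ≤ K := constSubspace_le_compactSubspace hf
  have hb : u - K.starProjection u ∈ Kᗮ := K.sub_starProjection_mem_orthogonal u
  obtain ⟨A, hA, hmix, hweak⟩ : ∃ A, HasDensityOne A ∧ (IsStronglyMixing μ f → A = Set.univ) ∧
      ∀ w, Tendsto (fun n => inner 𝕜 (U^[n] (u - K.starProjection u)) w) (atTop ⊓ 𝓟 A) (𝓝 0) := by
    by_cases hmix : IsStronglyMixing μ f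
    · refine ⟨Set.univ, hasDensityOne_univ, fun _ => rfl, fun w => ?_⟩
      rw [principal_univ, inf_top_eq]
      exact hmix.tendsto_inner hf (Submodule.orthogonal_le hconst hb) w
    · obtain ⟨A, hA, hweak⟩ := exists_hasDensityOne_tendsto_inner U
        (Submodule.orthogonal_le (finInvariantSpan U).le_topologicalClosure hb)
      exact ⟨A, hA, fun h => absurd h hmix, hweak⟩
  refine ⟨A, hA, hmix, fun W _ η hη => ?_⟩
  rw [← norm_sub_starProjection_eq_infDist]
  refine eventually_lt_infDist_iterate U ?_ hweak W hη
  rw [sub_sub_cancel]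
  exact hb _ (K.starProjection_apply_mem u)

end Strong

section VectorValued

theorem constSubspace_scalar : constSubspace μ ℂ ℂ = Submodule.span ℂ {Lp.const 2 μ (1 : ℂ)} := by
  rw [constSubspace, LinearMap.range_eq_map, ← Ideal.span_singleton_one, Submodule.map_span,
    Set.image_singleton]
  rfl

theorem mem_constSubspace_of_forall_proj {𝕜 : Type*} [RCLike 𝕜] {d : ℕ}
    {ψ : Lp (EuclideanSpace 𝕜 (Fin d)) 2 μ}
    (h : ∀ i, (EuclideanSpace.proj (𝕜 := 𝕜) i).compLp ψ ∈ constSubspace μ 𝕜 𝕜) :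
    ψ ∈ constSubspace μ 𝕜 (EuclideanSpace 𝕜 (Fin d)) := by
  choose a ha using h
  refine ⟨WithLp.toLp 2 a, Lp.ext ?_⟩
  have hcoord : ∀ᵐ x ∂μ, ∀ i, ψ x i = a i := ae_all_iff.2 fun i => by
    filter_upwards [(EuclideanSpace.proj (𝕜 := 𝕜) i).coeFn_compLp ψ,
      Lp.coeFn_const 2 μ (a i)] with x hproj hconst
    exact hproj.symm.trans ((congrArg (fun g : Lp 𝕜 2 μ => g x) (ha i)).symm.trans hconst)
  filter_upwards [hcoord, Lp.coeFn_const 2 μ (WithLp.toLp 2 a)] with x hx hconst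
  refine hconst.trans (PiLp.ext fun i => (hx i).symm)

theorem IsWeaklyMixing.compactSubspace_eq {d : ℕ} {hf : MeasurePreserving f μ μ}
    (h : IsWeaklyMixing hf) :
    compactSubspace (koopmanIsometry ℂ (EuclideanSpace ℂ (Fin d)) hf) =
      constSubspace μ ℂ (EuclideanSpace ℂ (Fin d)) := by
  rw [IsWeaklyMixing, discreteSubspace_eq_compactSubspace, ← constSubspace_scalar] at h
  refine le_antisymm (fun ψ hψ => mem_constSubspace_of_forall_proj fun i => ?_)
    (constSubspace_le_compactSubspace hf)
  let T : EuclideanSpace ℂ (Fin d) →L[ℝ] ℂ := (EuclideanSpace.proj i).restrictScalars ℝ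
  exact h.le (mapsTo_compactSubspace (T := T.compLpL 2 μ) (compLp_koopmanIsometry ℂ ℂ hf T) hψ)

theorem HasPurelyDiscreteSpectrum.compactSubspace_eq_top {E : Type*} [NormedAddCommGroup E]
    [InnerProductSpace ℂ E] {hf : MeasurePreserving f μ μ} (h : HasPurelyDiscreteSpectrum hf) :
    compactSubspace (koopmanIsometry ℂ E hf) = ⊤ := by
  rw [HasPurelyDiscreteSpectrum, discreteSubspace_eq_compactSubspace] at h
  refine top_le_iff.1 ((topologicalClosure_span_indicatorConstLp ℂ E).ge.trans
    (Submodule.topologicalClosure_minimal _ (Submodule.span_le.2 ?_)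
      (Submodule.isClosed_topologicalClosure _)))
  rintro _ ⟨A, hA, c, rfl⟩
  let T : ℂ →L[ℝ] E := (ContinuousLinearMap.toSpanSingleton ℂ c).restrictScalars ℝ
  have hT : indicatorConstLp 2 hA (measure_ne_top μ A) c =
      T.compLpL 2 μ (indicatorConstLp 2 hA (measure_ne_top μ A) 1) := by
    apply Lp.ext
    filter_upwards [T.coeFn_compLpL (indicatorConstLp 2 hA (measure_ne_top μ A) 1),
      indicatorConstLp_coeFn (p := 2) (hs := hA) (hμs := measure_ne_top μ A) (c := c),
      indicatorConstLp_coeFn (p := 2) (hs := hA) (hμs := measure_ne_top μ A) (c := (1 : ℂ))]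
      with x hTx hc hone
    rw [hTx, hc, hone]
    by_cases hx : x ∈ A <;> simp [hx, T]
  rw [hT]
  exact mapsTo_compactSubspace (T := T.compLpL 2 μ) (compLp_koopmanIsometry ℂ ℂ hf T)
    (h.ge Submodule.mem_top)

end VectorValued

end Mixing

section Residual

variable {M : Type*} [TopologicalSpace M] [SecondCountableTopology M] [MeasurableSpace M]
  [BorelSpace M] {μ : Measure M} [IsProbabilityMeasure μ] {d : ℕ} {f : M → M}
  {φ : M → EuclideanSpace ℝ (Fin d)} {hf : MeasurePreserving f μ μ}

theorem IsStronglyMixing.mixingResidual_eq_stdDev (h : IsStronglyMixing μ f)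
    (hμ : IsCompact μ.support) (hφ : Continuous φ) :
    mixingResidual hμ hφ hf = stdDev μ φ := by
  rw [mixingResidual_eq_infDist ℂ, h.compactSubspace_eq, infDist_constSubspace_obsL2]

theorem IsWeaklyMixing.mixingResidual_eq_stdDev (h : IsWeaklyMixing hf)
    (hμ : IsCompact μ.support) (hφ : Continuous φ) :
    mixingResidual hμ hφ hf = stdDev μ φ := by
  rw [mixingResidual_eq_infDist ℂ, h.compactSubspace_eq, infDist_constSubspace_obsL2]

theorem HasPurelyDiscreteSpectrum.mixingResidual_eq_zero (h : HasPurelyDiscreteSpectrum hf)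
    (hμ : IsCompact μ.support) (hφ : Continuous φ) : mixingResidual hμ hφ hf = 0 := by
  rw [mixingResidual_eq_infDist ℂ, h.compactSubspace_eq_top]
  exact Metric.infDist_zero_of_mem Submodule.mem_top

end Residual

theorem tendsto_of_eventually_sub_lt_of_le {ι : Type*} {l : Filter ι} {g : ι → ℝ} {c : ℝ}
    (hlt : ∀ η > 0, ∀ᶠ i in l, c - η < g i) (hle : ∀ i, g i ≤ c) : Tendsto g l (𝓝 c) := by
  refine tendsto_order.2 ⟨fun a ha => ?_, fun a ha => Eventually.of_forall fun i =>
    (hle i).trans_lt ha⟩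
  simpa only [sub_sub_cancel] using hlt (c - a) (sub_pos.2 ha)

section Hypothesis

variable {M : Type*} [MeasurableSpace M] {μ : Measure M} {𝕜 : Type*} [RCLike 𝕜] {d L : ℕ}
  {Φ : M → EuclideanSpace ℝ (Fin L)} {F : Submodule 𝕜 (Lp (EuclideanSpace 𝕜 (Fin d)) 2 μ)}
  {H : Submodule 𝕜 (EuclideanSpace ℝ (Fin L) → EuclideanSpace 𝕜 (Fin d))}
  {w : EuclideanSpace ℝ (Fin L) → EuclideanSpace ℝ (Fin d)}

/-- The functions `h` on `ℝ^L` for which `h ∘ Φ` represents a member of the subspace `F` of `L²`: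
the largest square-integrable class `H` with `hypSubspace μ Φ H ≤ F`. -/
def pullbackClass (Φ : M → EuclideanSpace ℝ (Fin L))
    (F : Submodule 𝕜 (Lp (EuclideanSpace 𝕜 (Fin d)) 2 μ)) :
    Submodule 𝕜 (EuclideanSpace ℝ (Fin L) → EuclideanSpace 𝕜 (Fin d)) where
  carrier := {h | ∃ ψ ∈ F, ψ =ᵐ[μ] fun ω => h (Φ ω)}
  zero_mem' := ⟨0, F.zero_mem, Lp.coeFn_zero _ _ _⟩
  add_mem' := by
    rintro h k ⟨a, haF, ha⟩ ⟨b, hbF, hb⟩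
    exact ⟨a + b, F.add_mem haF hbF, (Lp.coeFn_add a b).trans (ha.add hb)⟩
  smul_mem' := by
    rintro c h ⟨a, haF, ha⟩
    exact ⟨c • a, F.smul_mem c haF, (Lp.coeFn_smul c a).trans (ha.const_smul c)⟩

theorem isSquareIntegrableClass_pullbackClass :
    IsSquareIntegrableClass μ Φ (pullbackClass Φ F) := by
  rintro h ⟨ψ, _, hψ⟩
  exact (memLp_congr_ae hψ).1 (Lp.memLp ψ)

theorem hypSubspace_pullbackClass {s : Set M} (hΦ : Set.InjOn Φ s) (hs : s ∈ ae μ) :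
    hypSubspace μ Φ (pullbackClass Φ F) = F := by
  ext ψ
  refine ⟨fun ⟨h, ⟨χ, hχF, hχ⟩, hψ⟩ => ?_, fun hψ => ?_⟩
  · rwa [Lp.ext (hψ.trans hχ.symm)]
  · rcases isEmpty_or_nonempty M with hM | hM
    · exact ⟨0, Submodule.zero_mem _, Eventually.of_forall fun ω => hM.elim ω⟩
    have hfactor : ψ =ᵐ[μ] fun ω => ψ (Function.invFunOn Φ s (Φ ω)) := by
      filter_upwards [hs] with ω hω
      rw [hΦ.leftInvOn_invFunOn hω]
    exact ⟨fun y => ψ (Function.invFunOn Φ s y), ⟨ψ, hψ, hfactor⟩, hfactor⟩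

theorem IsHypothesisSpace.constSubspace_le [IsFiniteMeasure μ] (hH : IsHypothesisSpace μ Φ H) :
    constSubspace μ 𝕜 (EuclideanSpace 𝕜 (Fin d)) ≤ hypSubspace μ Φ H := by
  rintro _ ⟨c, rfl⟩
  exact hH.const_mem c

theorem toLp_mem_hypSubspace {h : EuclideanSpace ℝ (Fin L) → EuclideanSpace 𝕜 (Fin d)} (hh : h ∈ H)
    (hL : MemLp (fun ω => h (Φ ω)) 2 μ) : hL.toLp ∈ hypSubspace μ Φ H :=
  ⟨h, hh, hL.coeFn_toLp⟩

theorem norm_sub_hypProj (x : Lp (EuclideanSpace 𝕜 (Fin d)) 2 μ) :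
    ‖x - hypProj μ Φ H x‖ = Metric.infDist x (hypSubspace μ Φ H) := by
  rw [hypProj, norm_sub_starProjection_eq_infDist, Submodule.topologicalClosure_coe,
    Metric.infDist_closure]

theorem eLpNorm_sub_eq_edist {E : Type*} [NormedAddCommGroup E] {x y : Lp E 2 μ} {g h : M → E}
    (hx : x =ᵐ[μ] g) (hy : y =ᵐ[μ] h) : eLpNorm (fun ω => g ω - h ω) 2 μ = edist x y := by
  rw [Lp.edist_def]
  exact eLpNorm_congr_ae (hx.symm.sub hy.symm)

theorem IsClosestApprox.eLpNorm_eq_infEDist (hH : IsSquareIntegrableClass μ Φ H)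
    {wHat : EuclideanSpace ℝ (Fin L) → EuclideanSpace 𝕜 (Fin d)}
    (h : IsClosestApprox μ Φ H w wHat) {x : Lp (EuclideanSpace 𝕜 (Fin d)) 2 μ}
    (hx : x =ᵐ[μ] fun ω => ofRealVec 𝕜 (w (Φ ω))) :
    eLpNorm (fun ω => ofRealVec 𝕜 (w (Φ ω)) - wHat (Φ ω)) 2 μ =
      Metric.infEDist x (hypSubspace μ Φ H) := by
  refine le_antisymm (Metric.le_infEDist.2 ?_) ?_
  · rintro y ⟨k, hk, hy⟩
    rw [← eLpNorm_sub_eq_edist hx hy]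
    exact h.2 k hk
  · rw [eLpNorm_sub_eq_edist hx (hH wHat h.1).coeFn_toLp]
    exact Metric.infEDist_le_edist_of_mem (toLp_mem_hypSubspace h.1 (hH wHat h.1))

theorem exists_isClosestApprox (hH : IsSquareIntegrableClass μ Φ H)
    [FiniteDimensional 𝕜 (hypSubspace μ Φ H)] {x : Lp (EuclideanSpace 𝕜 (Fin d)) 2 μ}
    (hx : x =ᵐ[μ] fun ω => ofRealVec 𝕜 (w (Φ ω))) : ∃ wHat, IsClosestApprox μ Φ H w wHat := by
  obtain ⟨h, hh, hy⟩ := (hypSubspace μ Φ H).starProjection_apply_mem x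
  refine ⟨h, hh, fun k hk => ?_⟩
  rw [eLpNorm_sub_eq_edist hx hy, eLpNorm_sub_eq_edist hx (hH k hk).coeFn_toLp, edist_dist,
    edist_dist, dist_eq_norm, norm_sub_starProjection_eq_infDist]
  exact ENNReal.ofReal_le_ofReal
    (Metric.infDist_le_dist_of_mem (toLp_mem_hypSubspace hk (hH k hk)))

end Hypothesis

section DirectError

variable {M : Type*} [TopologicalSpace M] [SecondCountableTopology M] [MeasurableSpace M]
  [BorelSpace M] {μ : Measure M} [IsProbabilityMeasure μ] {𝕜 : Type*} [RCLike 𝕜] {d L : ℕ}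
  {f : M → M} {φ : M → EuclideanSpace ℝ (Fin d)} {Φ : M → EuclideanSpace ℝ (Fin L)}
  {H : Submodule 𝕜 (EuclideanSpace ℝ (Fin L) → EuclideanSpace 𝕜 (Fin d))}
  {w : EuclideanSpace ℝ (Fin L) → EuclideanSpace ℝ (Fin d)} {n : ℕ}

theorem koopmanIsometry_iterate_obsL2_eq_comp (𝕜 : Type*) [RCLike 𝕜]
    (hf : MeasurePreserving f μ μ) (hμ : IsCompact μ.support) (hφ : Continuous φ)
    (hw : ∀ ω ∈ μ.support, w (Φ ω) = φ (f^[n] ω)) :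
    (koopmanIsometry 𝕜 (EuclideanSpace 𝕜 (Fin d)) hf)^[n] (obsL2 𝕜 hμ hφ) =ᵐ[μ]
      fun ω => ofRealVec 𝕜 (w (Φ ω)) := by
  filter_upwards [koopmanIsometry_iterate_obsL2 𝕜 hμ hφ hf n, Measure.support_mem_ae]
    with ω hω hsupp
  rw [hω, hw ω hsupp]

theorem IsClosestApprox.directError_eq_infDist (hf : MeasurePreserving f μ μ)
    (hμ : IsCompact μ.support) (hφ : Continuous φ) (hH : IsSquareIntegrableClass μ Φ H)
    (hw : ∀ ω ∈ μ.support, w (Φ ω) = φ (f^[n] ω))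
    {wHat : EuclideanSpace ℝ (Fin L) → EuclideanSpace 𝕜 (Fin d)}
    (h : IsClosestApprox μ Φ H w wHat) :
    directError μ f φ Φ wHat n = Metric.infDist
      ((koopmanIsometry 𝕜 (EuclideanSpace 𝕜 (Fin d)) hf)^[n] (obsL2 𝕜 hμ hφ))
      (hypSubspace μ Φ H) := by
  rw [Metric.infDist,
    ← h.eLpNorm_eq_infEDist hH (koopmanIsometry_iterate_obsL2_eq_comp 𝕜 hf hμ hφ hw), directError]
  refine congrArg ENNReal.toReal (eLpNorm_congr_ae ?_)
  filter_upwards [Measure.support_mem_ae (μ := μ)] with ω hω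
  rw [hw ω hω]

theorem exists_isHypothesisSpace_infDist_lt (𝕜 : Type*) [RCLike 𝕜]
    (hf : MeasurePreserving f μ μ) (hμ : IsCompact μ.support) (hφ : Continuous φ)
    (hΦ : Set.InjOn Φ μ.support) {r : ℝ} (hr : mixingResidual hμ hφ hf < r) :
    ∃ H : Submodule 𝕜 (EuclideanSpace ℝ (Fin L) → EuclideanSpace 𝕜 (Fin d)),
      IsHypothesisSpace μ Φ H ∧
      IsFinInvariant (koopmanIsometry 𝕜 (EuclideanSpace 𝕜 (Fin d)) hf) (hypSubspace μ Φ H) ∧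
      Metric.infDist (obsL2 𝕜 hμ hφ) (hypSubspace μ Φ H) < r := by
  rw [mixingResidual_eq_infDist 𝕜] at hr
  obtain ⟨F, hF, hconst, hlt⟩ := (isFinInvariant_constSubspace hf).exists_le_infDist_lt hr
  have hHF : hypSubspace μ Φ (pullbackClass Φ F) = F :=
    hypSubspace_pullbackClass hΦ Measure.support_mem_ae
  rw [← hHF] at hF hconst hlt
  exact ⟨_, ⟨isSquareIntegrableClass_pullbackClass, hF.finiteDimensional,
    fun c => hconst (const_mem_constSubspace c)⟩, hF, hlt⟩

theorem IsFinInvariant.mixingResidual_le_infDist {hf : MeasurePreserving f μ μ}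
    {F : Submodule 𝕜 (Lp (EuclideanSpace 𝕜 (Fin d)) 2 μ)}
    (hF : IsFinInvariant (koopmanIsometry 𝕜 (EuclideanSpace 𝕜 (Fin d)) hf) F)
    (hμ : IsCompact μ.support) (hφ : Continuous φ) :
    mixingResidual hμ hφ hf ≤ Metric.infDist (obsL2 𝕜 hμ hφ) F := by
  rw [mixingResidual_eq_infDist 𝕜]
  exact Metric.infDist_le_infDist_of_subset
    (hF.le_finInvariantSpan.trans (Submodule.le_topologicalClosure _)) F.nonempty

theorem IsHypothesisSpace.infDist_iterate_le_stdDev (hH : IsHypothesisSpace μ Φ H)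
    (hf : MeasurePreserving f μ μ) (hμ : IsCompact μ.support) (hφ : Continuous φ) (n : ℕ) :
    Metric.infDist ((koopmanIsometry 𝕜 (EuclideanSpace 𝕜 (Fin d)) hf)^[n] (obsL2 𝕜 hμ hφ))
      (hypSubspace μ Φ H) ≤ stdDev μ φ := by
  rw [← infDist_constSubspace_obsL2 𝕜 hμ hφ]
  exact (isFinInvariant_constSubspace hf).infDist_iterate_le hH.constSubspace_le n _

end DirectError

end DirectForecast

theorem theorem5p1_general {d L : ℕ} {M : Type*} [TopologicalSpace M] [SecondCountableTopology M]
    [MeasurableSpace M] [BorelSpace M] (f : M → M) (μ : Measure M) [IsProbabilityMeasure μ]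
    (hf : MeasurePreserving f μ μ) (hΩ : IsCompact μ.support)
    (φ : M → EuclideanSpace ℝ (Fin d)) (hφ : Continuous φ)
    (Φ : M → EuclideanSpace ℝ (Fin L)) (hΦ : Set.InjOn Φ μ.support)
    (w : ℕ → EuclideanSpace ℝ (Fin L) → EuclideanSpace ℝ (Fin d))
    (hw : ∀ k : ℕ, ∀ ω ∈ μ.support, w k (Φ ω) = φ (f^[k] ω))
    (𝕜 : Type*) [RCLike 𝕜] :
    (∀ H : Submodule 𝕜 (EuclideanSpace ℝ (Fin L) → EuclideanSpace 𝕜 (Fin d)),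
      IsSquareIntegrableClass μ Φ H →
      ∀ (n : ℕ) (wHat : EuclideanSpace ℝ (Fin L) → EuclideanSpace 𝕜 (Fin d)),
        IsClosestApprox μ Φ H (w n) wHat →
        directError μ f φ Φ wHat n =
          ‖((koopman 𝕜 (EuclideanSpace 𝕜 (Fin d)) hf) ^ n)
                (obsL2 𝕜 hΩ hφ) -
            hypProj μ Φ H
              (((koopman 𝕜 (EuclideanSpace 𝕜 (Fin d)) hf) ^ n)
                (obsL2 𝕜 hΩ hφ))‖) ∧
    (∀ H : Submodule 𝕜 (EuclideanSpace ℝ (Fin L) → EuclideanSpace 𝕜 (Fin d)),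
      IsHypothesisSpace μ Φ H →
      ∀ n : ℕ, ∃ wHat, IsClosestApprox μ Φ H (w n) wHat) ∧
    ∃ N' : Set ℕ, HasDensityOne N' ∧
      (∀ H : Submodule 𝕜 (EuclideanSpace ℝ (Fin L) → EuclideanSpace 𝕜 (Fin d)),
        IsHypothesisSpace μ Φ H →
        ∀ wHat : ℕ → EuclideanSpace ℝ (Fin L) → EuclideanSpace 𝕜 (Fin d),
          (∀ n, IsClosestApprox μ Φ H (w n) (wHat n)) →
          ∀ η : ℝ, 0 < η → ∀ᶠ n in atTop ⊓ 𝓟 N',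
            mixingResidual hΩ hφ hf - η <
              directError μ f φ Φ (wHat n) n) ∧
      (∀ ε : ℝ, 0 < ε → ∃ H₀ : Submodule 𝕜 (EuclideanSpace ℝ (Fin L) → EuclideanSpace 𝕜 (Fin d)),
        IsHypothesisSpace μ Φ H₀ ∧
        (∃ l : ℝ,
          mixingResidual hΩ hφ hf ≤ l ∧
          l < mixingResidual hΩ hφ hf + ε ∧
          ∀ wHat : ℕ → EuclideanSpace ℝ (Fin L) → EuclideanSpace 𝕜 (Fin d),
            (∀ n, IsClosestApprox μ Φ H₀ (w n) (wHat n)) →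
            Tendsto (fun n => directError μ f φ Φ (wHat n) n)
              (atTop ⊓ 𝓟 N') (𝓝 l)) ∧
        ∀ H : Submodule 𝕜 (EuclideanSpace ℝ (Fin L) → EuclideanSpace 𝕜 (Fin d)),
          IsHypothesisSpace μ Φ H →
          hypSubspace μ Φ H₀ ≤ hypSubspace μ Φ H →
          ∀ wHat : ℕ → EuclideanSpace ℝ (Fin L) → EuclideanSpace 𝕜 (Fin d),
            (∀ n, IsClosestApprox μ Φ H (w n) (wHat n)) →
            ∀ᶠ n in atTop ⊓ 𝓟 N',
              directError μ f φ Φ (wHat n) n <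
                mixingResidual hΩ hφ hf + ε) ∧
      (IsWeaklyMixing hf →
        ∀ H : Submodule 𝕜 (EuclideanSpace ℝ (Fin L) → EuclideanSpace 𝕜 (Fin d)),
          IsHypothesisSpace μ Φ H →
          ∀ wHat : ℕ → EuclideanSpace ℝ (Fin L) → EuclideanSpace 𝕜 (Fin d),
            (∀ n, IsClosestApprox μ Φ H (w n) (wHat n)) →
            Tendsto (fun n => directError μ f φ Φ (wHat n) n)
              (atTop ⊓ 𝓟 N') (𝓝 (stdDev μ φ))) ∧
      (IsStronglyMixing μ f → N' = Set.univ ∧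
        ∀ H : Submodule 𝕜 (EuclideanSpace ℝ (Fin L) → EuclideanSpace 𝕜 (Fin d)),
          IsHypothesisSpace μ Φ H →
          ∀ wHat : ℕ → EuclideanSpace ℝ (Fin L) → EuclideanSpace 𝕜 (Fin d),
            (∀ n, IsClosestApprox μ Φ H (w n) (wHat n)) →
            Tendsto (fun n => directError μ f φ Φ (wHat n) n)
              atTop (𝓝 (stdDev μ φ))) ∧
      (HasPurelyDiscreteSpectrum hf →
        ∀ ε : ℝ, 0 < ε → ∃ H₀ : Submodule 𝕜 (EuclideanSpace ℝ (Fin L) → EuclideanSpace 𝕜 (Fin d)),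
          IsHypothesisSpace μ Φ H₀ ∧
          ∀ H : Submodule 𝕜 (EuclideanSpace ℝ (Fin L) → EuclideanSpace 𝕜 (Fin d)),
            IsHypothesisSpace μ Φ H →
            hypSubspace μ Φ H₀ ≤ hypSubspace μ Φ H →
            ∀ wHat : ℕ → EuclideanSpace ℝ (Fin L) → EuclideanSpace 𝕜 (Fin d),
              (∀ n, IsClosestApprox μ Φ H (w n) (wHat n)) →
              ∀ n : ℕ, directError μ f φ Φ (wHat n) n < ε) := by
  set U := koopmanIsometry 𝕜 (EuclideanSpace 𝕜 (Fin d)) hf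
  set u := obsL2 𝕜 hΩ hφ
  have herr {H : Submodule 𝕜 (EuclideanSpace ℝ (Fin L) → EuclideanSpace 𝕜 (Fin d))}
      {n wHat} (hH : IsSquareIntegrableClass μ Φ H) (h : IsClosestApprox μ Φ H (w n) wHat) :
      directError μ f φ Φ wHat n = Metric.infDist (U^[n] u) (hypSubspace μ Φ H) :=
    h.directError_eq_infDist hf hΩ hφ hH (hw n)
  obtain ⟨N', hN', huniv, hlower⟩ := exists_hasDensityOne_eventually_lt_infDist (𝕜 := 𝕜) hf u
  rw [← mixingResidual_eq_infDist] at hlower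
  have hlim (hres : mixingResidual hΩ hφ hf = stdDev μ φ)
      {H : Submodule 𝕜 (EuclideanSpace ℝ (Fin L) → EuclideanSpace 𝕜 (Fin d))}
      (hH : IsHypothesisSpace μ Φ H) :
      Tendsto (fun n => Metric.infDist (U^[n] u) (hypSubspace μ Φ H)) (atTop ⊓ 𝓟 N')
        (𝓝 (stdDev μ φ)) := by
    have := hH.finiteDimensional
    exact tendsto_of_eventually_sub_lt_of_le (fun η hη => hres ▸ hlower _ hη)
      (hH.infDist_iterate_le_stdDev hf hΩ hφ)
  refine ⟨fun H hH n wHat h => ?_, fun H hH n => ?_, N', hN', fun H hH wHat h η hη => ?_,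
    fun ε hε => ?_, fun hmix H hH wHat h => ?_, fun hmix => ⟨huniv hmix, fun H hH wHat h => ?_⟩,
    fun hdisc ε hε => ?_⟩
  · rw [herr hH h, koopman_pow_apply, norm_sub_hypProj]
  · have := hH.finiteDimensional
    exact exists_isClosestApprox hH.memLp (koopmanIsometry_iterate_obsL2_eq_comp 𝕜 hf hΩ hφ (hw n))
  · have := hH.finiteDimensional
    simpa only [fun n => herr hH.memLp (h n)] using hlower _ hη
  · obtain ⟨H₀, hH₀, hinv, hlt⟩ :=
      exists_isHypothesisSpace_infDist_lt 𝕜 hf hΩ hφ hΦ (lt_add_of_pos_right _ hε)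
    refine ⟨H₀, hH₀, ⟨_, hinv.mixingResidual_le_infDist hΩ hφ, hlt, fun wHat h => ?_⟩,
      fun H hH hle wHat h => Eventually.of_forall fun n => ?_⟩
    · exact tendsto_const_nhds.congr fun n =>
        ((herr hH₀.memLp (h n)).trans (hinv.infDist_iterate n u)).symm
    · exact (herr hH.memLp (h n)).trans_lt ((hinv.infDist_iterate_le hle n u).trans_lt hlt)
  · simpa only [fun n => herr hH.memLp (h n)] using
      hlim (hmix.mixingResidual_eq_stdDev hΩ hφ) hH
  · simpa only [fun n => herr hH.memLp (h n), huniv hmix, principal_univ, inf_top_eq] using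
      hlim (hmix.mixingResidual_eq_stdDev hΩ hφ) hH
  · obtain ⟨H₀, hH₀, hinv, hlt⟩ := exists_isHypothesisSpace_infDist_lt 𝕜 hf hΩ hφ hΦ
      ((hdisc.mixingResidual_eq_zero hΩ hφ).trans_lt hε)
    exact ⟨H₀, hH₀, fun H hH hle wHat h n =>
      (herr hH.memLp (h n)).trans_lt ((hinv.infDist_iterate_le hle n u).trans_lt hlt)⟩

theorem theorem5p1 {m d L : ℕ} {M : Type*} [TopologicalSpace M] [T2Space M]
    [SecondCountableTopology M] [ChartedSpace (EuclideanSpace ℝ (Fin m)) M]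
    [IsManifold (𝓡 m) 1 M] [MeasurableSpace M] [BorelSpace M]
    -- the dynamical system and its ergodic measure with compact support
    (f : M → M) (hf : ContMDiff (𝓡 m) (𝓡 m) 1 f)
    (μ : Measure M) [IsProbabilityMeasure μ] (hμ : Ergodic f μ) (hΩ : IsCompact μ.support)
    -- the measurement
    (φ : M → EuclideanSpace ℝ (Fin d)) (hφ : ContMDiff (𝓡 m) (𝓡 d) 1 φ)
    -- the embedding of the support, and the embedding mechanism
    (Φ : M → EuclideanSpace ℝ (Fin L)) (hΦ : Set.InjOn Φ μ.support)
    (g : EuclideanSpace ℝ (Fin d) × EuclideanSpace ℝ (Fin L) → EuclideanSpace ℝ (Fin L))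
    (hg : ∀ ω ∈ μ.support, Φ (f ω) = g (φ ω, Φ ω))
    -- the feedback functions
    (w : ℕ → EuclideanSpace ℝ (Fin L) → EuclideanSpace ℝ (Fin d))
    (hw : ∀ k : ℕ, ∀ ω ∈ μ.support, w k (Φ ω) = φ (f^[k] ω))
    -- the scalars of the hypothesis spaces, real or complex
    (𝕜 : Type*) [RCLike 𝕜] :
    -- the formula for the error, for an arbitrary linear space of functions
    (∀ H : Submodule 𝕜 (EuclideanSpace ℝ (Fin L) → EuclideanSpace 𝕜 (Fin d)),
      IsSquareIntegrableClass μ Φ H →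
      ∀ (n : ℕ) (wHat : EuclideanSpace ℝ (Fin L) → EuclideanSpace 𝕜 (Fin d)),
        IsClosestApprox μ Φ H (w n) wHat →
        directError μ f φ Φ wHat n =
          ‖((koopman 𝕜 (EuclideanSpace 𝕜 (Fin d)) hμ.toMeasurePreserving) ^ n)
                (obsL2 𝕜 hΩ hφ.continuous) -
            hypProj μ Φ H
              (((koopman 𝕜 (EuclideanSpace 𝕜 (Fin d)) hμ.toMeasurePreserving) ^ n)
                (obsL2 𝕜 hΩ hφ.continuous))‖) ∧
    -- closest approximations exist in hypothesis spaces
    (∀ H : Submodule 𝕜 (EuclideanSpace ℝ (Fin L) → EuclideanSpace 𝕜 (Fin d)),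
      IsHypothesisSpace μ Φ H →
      ∀ n : ℕ, ∃ wHat, IsClosestApprox μ Φ H (w n) wHat) ∧
    ∃ N' : Set ℕ, HasDensityOne N' ∧
      -- (i) for every hypothesis space, no limit point is below the distance of `φ` to `𝒟`; for
      -- every large enough one, all limit points are within `ε` of it; and the limit exists for
      -- some such choice
      (∀ H : Submodule 𝕜 (EuclideanSpace ℝ (Fin L) → EuclideanSpace 𝕜 (Fin d)),
        IsHypothesisSpace μ Φ H →
        ∀ wHat : ℕ → EuclideanSpace ℝ (Fin L) → EuclideanSpace 𝕜 (Fin d),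
          (∀ n, IsClosestApprox μ Φ H (w n) (wHat n)) →
          ∀ η : ℝ, 0 < η → ∀ᶠ n in atTop ⊓ 𝓟 N',
            mixingResidual hΩ hφ.continuous hμ.toMeasurePreserving - η <
              directError μ f φ Φ (wHat n) n) ∧
      (∀ ε : ℝ, 0 < ε → ∃ H₀ : Submodule 𝕜 (EuclideanSpace ℝ (Fin L) → EuclideanSpace 𝕜 (Fin d)),
        IsHypothesisSpace μ Φ H₀ ∧
        (∃ l : ℝ,
          mixingResidual hΩ hφ.continuous hμ.toMeasurePreserving ≤ l ∧
          l < mixingResidual hΩ hφ.continuous hμ.toMeasurePreserving + ε ∧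
          ∀ wHat : ℕ → EuclideanSpace ℝ (Fin L) → EuclideanSpace 𝕜 (Fin d),
            (∀ n, IsClosestApprox μ Φ H₀ (w n) (wHat n)) →
            Tendsto (fun n => directError μ f φ Φ (wHat n) n)
              (atTop ⊓ 𝓟 N') (𝓝 l)) ∧
        ∀ H : Submodule 𝕜 (EuclideanSpace ℝ (Fin L) → EuclideanSpace 𝕜 (Fin d)),
          IsHypothesisSpace μ Φ H →
          hypSubspace μ Φ H₀ ≤ hypSubspace μ Φ H →
          ∀ wHat : ℕ → EuclideanSpace ℝ (Fin L) → EuclideanSpace 𝕜 (Fin d),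
            (∀ n, IsClosestApprox μ Φ H (w n) (wHat n)) →
            ∀ᶠ n in atTop ⊓ 𝓟 N',
              directError μ f φ Φ (wHat n) n <
                mixingResidual hΩ hφ.continuous hμ.toMeasurePreserving + ε) ∧
      -- (ii) weak mixing
      (IsWeaklyMixing hμ.toMeasurePreserving →
        ∀ H : Submodule 𝕜 (EuclideanSpace ℝ (Fin L) → EuclideanSpace 𝕜 (Fin d)),
          IsHypothesisSpace μ Φ H →
          ∀ wHat : ℕ → EuclideanSpace ℝ (Fin L) → EuclideanSpace 𝕜 (Fin d),
            (∀ n, IsClosestApprox μ Φ H (w n) (wHat n)) →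
            Tendsto (fun n => directError μ f φ Φ (wHat n) n)
              (atTop ⊓ 𝓟 N') (𝓝 (stdDev μ φ))) ∧
      -- (iii) strong mixing: the whole of `ℕ`
      (IsStronglyMixing μ f → N' = Set.univ ∧
        ∀ H : Submodule 𝕜 (EuclideanSpace ℝ (Fin L) → EuclideanSpace 𝕜 (Fin d)),
          IsHypothesisSpace μ Φ H →
          ∀ wHat : ℕ → EuclideanSpace ℝ (Fin L) → EuclideanSpace 𝕜 (Fin d),
            (∀ n, IsClosestApprox μ Φ H (w n) (wHat n)) →
            Tendsto (fun n => directError μ f φ Φ (wHat n) n)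
              atTop (𝓝 (stdDev μ φ))) ∧
      -- (iv) purely discrete spectrum
      (HasPurelyDiscreteSpectrum hμ.toMeasurePreserving →
        ∀ ε : ℝ, 0 < ε → ∃ H₀ : Submodule 𝕜 (EuclideanSpace ℝ (Fin L) → EuclideanSpace 𝕜 (Fin d)),
          IsHypothesisSpace μ Φ H₀ ∧
          ∀ H : Submodule 𝕜 (EuclideanSpace ℝ (Fin L) → EuclideanSpace 𝕜 (Fin d)),
            IsHypothesisSpace μ Φ H →
            hypSubspace μ Φ H₀ ≤ hypSubspace μ Φ H →
            ∀ wHat : ℕ → EuclideanSpace ℝ (Fin L) → EuclideanSpace 𝕜 (Fin d),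
              (∀ n, IsClosestApprox μ Φ H (w n) (wHat n)) →
              ∀ n : ℕ, directError μ f φ Φ (wHat n) n < ε) :=
  theorem5p1_general f μ hμ.toMeasurePreserving hΩ φ hφ.continuous Φ hΦ w hw 𝕜
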